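/- Let $\mathfrak g$ be a finite-dimensional simple complex Lie algebra of simply laced type, with Cartan subalgebra $\mathfrak h$, root system $\Delta$, simple roots $\alpha_1,\dots,\alpha_s$, height function $\mathrm{ht}$, highest root $\theta$, and a nondegenerate symmetric invariant bilinear form $(\cdot|\cdot)$. Let $$\mathfrak T=\mathfrak g\otimes\mathbb C[t_1^{\pm1},t_2^{\pm1}]\oplus\mathbb Cc_1\oplus\mathbb Cc_2\oplus\mathbb Cd_1\oplus\mathbb Cd_2$$ be the extended double affine Lie algebra: writing $x(m)=x\otimes t_1^{m_1}t_2^{m_2}$ for $m=(m_1,m_2)\in\mathbb Z^2$, $$[x(m),y(n)]=[x,y](m+n)+(x|y)\,\delta_{m+n,0}\,(m_1c_1+m_2c_2),\qquad [d_i,x(m)]=m_i\,x(m),$$ $c_1,c_2$ are central and $[d_1,d_2]=0$. Put $\hat{\mathfrak h}=\mathfrak h\oplus\mathbb Cc_1\oplus\mathbb Cc_2\oplus\mathbb Cd_1\oplus\mathbb Cd_2$; let $\mathfrak T_\beta$ $(\beta\in\hat{\mathfrak h}^*)$ be the root spaces of $\mathfrak T$, and $\Delta_{\mathfrak T}=\{\beta\neq0:\mathfrak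 T_\beta\neq0\}$. Let $\delta_i\in\hat{\mathfrak h}^*$ vanish on $\mathfrak h,c_1,c_2$ with $\delta_i(d_j)=\delta_{ij}$, extend functionals on $\mathfrak h$ to $\hat{\mathfrak h}$ by zero, and put $\alpha_{-1}=\delta_2-\theta$, $\alpha_0=\delta_1-\theta$. Choose $\alpha_i^*\in\hat{\mathfrak h}$ with $\alpha_j(\alpha_i^*)=\delta_{ij}$ for $i,j\in\{-1,0,\dots,s\}$ and set $\varphi=\sum_{i=0}^s\alpha_i^*-\mathrm{ht}(\theta)\alpha_{-1}^*$, $$\mathcal I=\{\beta\in\Delta_{\mathfrak T}:\beta(\varphi)>0\}\cup\{n\delta_2:n\ge1\},\qquad \mathfrak T_{\pm\mathcal I}=\bigoplus_{\beta\in\pm\mathcal I}\mathfrak T_\beta,\qquad \mathfrak b_{\mathcal I}=\hat{\mathfrak h}\oplus\mathfrak T_{\mathcal I}.$$ For $\lambda\in\hat{\mathfrak h}^*$ let $\mathbb C1_\lambda$ be the one-dimensional $\mathfrak b_{\mathcal I}$-module with $(h+x)1_\lambda=\lambda(h)1_\lambda$ for $h\in\hat{\mathfrak h}$, $x\in\mathfrak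 T_{\mathcal I}$, and let $\overline M(\lambda)=U(\mathfrak T)\otimes_{U(\mathfrak b_{\mathcal I})}\mathbb C1_\lambda$ be the imaginary Verma module. For a $\mathfrak T$-module $V$ put $V_\mu=\{v\in V: hv=\mu(h)v\ \text{for all } h\in\hat{\mathfrak h}\}$; an imaginary highest vector of weight $\lambda$ is a nonzero $v\in V_\lambda$ with $\mathfrak T_{\mathcal I}v=0$, and $V$ is an imaginary highest weight module of highest weight $\lambda$ if $V=U(\mathfrak T)v$ for such a $v$. Then for every $\lambda\in\hat{\mathfrak h}^*$: 1. $1\otimes1_\lambda$ is an imaginary highest vector of weight $\lambda$, and $\overline M(\lambda)$ is a free $U(\mathfrak T_{-\mathcal I})$-module with basis $\{1\otimes1_\lambda\}$. 2. (a) $\dim\overline M(\lambda)_\lambda=1$. (b) $0<\dim\overline M(\lambda)_{\lambda-k\delta_2}<\infty$ for every positive integer $k$. (c) If $\overline M(\lambda)_\mu\neq0$ and $\mu\neq\lambda-k\delta_2$ for every integer $k\ge0$, then $\dim\overline M(\lambda)_\mu=\infty$. 3. Every imaginary highest weight $\mathfrak T$-module $V$ of highest weight $\lambda$ is a quotient of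 $\overline M(\lambda)$: if $V=U(\mathfrak T)v$ with $v$ an imaginary highest vector of weight $\lambda$, there is a surjective $\mathfrak T$-homomorphism $\overline M(\lambda)\to V$ with $1\otimes1_\lambda\mapsto v$. 4. $\overline M(\lambda)$ has a unique maximal (proper) submodule. 5. For every $\mu\in\hat{\mathfrak h}^*$, every nonzero $\mathfrak T$-homomorphism $\overline M(\lambda)\to\overline M(\mu)$ is injective. -/

import Mathlib

open scoped TensorProduct

noncomputable section

namespace DoubleAffine

/-! ### Induced modules -/

section Induced

attribute [local instance 100] LieRing.ofAssociativeRing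

variable {L : Type*} [LieRing L] [LieAlgebra ℂ L]

/-- The algebra map `U(𝔟) → U(L)` induced by the inclusion of a Lie subalgebra `𝔟` of `L`. -/
def envMap (𝔟 : LieSubalgebra ℂ L) :
    UniversalEnvelopingAlgebra ℂ 𝔟 →ₐ[ℂ] UniversalEnvelopingAlgebra ℂ L :=
  UniversalEnvelopingAlgebra.lift ℂ ((UniversalEnvelopingAlgebra.ι ℂ).comp 𝔟.incl)

/-- The action of `U(L)` on an `L`-module. -/
def envAct (V : Type*) [AddCommGroup V] [Module ℂ V] [LieRingModule L V] [LieModule ℂ L V] :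
    UniversalEnvelopingAlgebra ℂ L →ₐ[ℂ] Module.End ℂ V :=
  UniversalEnvelopingAlgebra.lift ℂ (LieModule.toEnd ℂ L V)

/-- The `U(L)`-submodule of `U(L) ⊗_ℂ W` generated by the elements `u b ⊗ w - u ⊗ b w`, with
`u ∈ U(L)`, `b ∈ U(𝔟)`, `w ∈ W`, where `W` is a `𝔟`-module through `ρ`. -/
def inducedRel (𝔟 : LieSubalgebra ℂ L) {W : Type*} [AddCommGroup W] [Module ℂ W]
    (ρ : 𝔟 →ₗ⁅ℂ⁆ Module.End ℂ W) :
    Submodule (UniversalEnvelopingAlgebra ℂ L) (UniversalEnvelopingAlgebra ℂ L ⊗[ℂ] W) :=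
  Submodule.span _ {z | ∃ (u : UniversalEnvelopingAlgebra ℂ L)
    (b : UniversalEnvelopingAlgebra ℂ 𝔟) (w : W),
    z = (u * envMap 𝔟 b) ⊗ₜ[ℂ] w - u ⊗ₜ[ℂ] (UniversalEnvelopingAlgebra.lift ℂ ρ b w)}

/-- The induced module `U(L) ⊗_{U(𝔟)} W`: the tensor product over the noncommutative ring `U(𝔟)`,
as a quotient of `U(L) ⊗_ℂ W`. -/
abbrev Induced (𝔟 : LieSubalgebra ℂ L) {W : Type*} [AddCommGroup W] [Module ℂ W]
    (ρ : 𝔟 →ₗ⁅ℂ⁆ Module.End ℂ W) : Type _ :=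
  (UniversalEnvelopingAlgebra ℂ L ⊗[ℂ] W) ⧸ inducedRel 𝔟 ρ

end Induced

/-! ### The extended double affine Lie algebra -/

/-- The group algebra of `ℤ²`, i.e. the Laurent polynomial ring `ℂ[t₁^{±1}, t₂^{±1}]`; the
exponents of `t₁`, `t₂` are the coordinates `0`, `1` of `Fin 2 → ℤ`. -/
abbrev Laurent₂ : Type := AddMonoidAlgebra ℂ (Fin 2 → ℤ)

/-- The degree derivation `t_i ∂/∂t_i` of `ℂ[t₁^{±1}, t₂^{±1}]`. -/
def degLaurent (i : Fin 2) : Laurent₂ →ₗ[ℂ] Laurent₂ :=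
  (AddMonoidAlgebra.basis (Fin 2 → ℤ) ℂ).constr ℂ
    fun m => (m i : ℂ) • AddMonoidAlgebra.single m 1

/-- The constant coefficient of a Laurent polynomial. -/
def constCoeff : Laurent₂ →ₗ[ℂ] ℂ :=
  (AddMonoidAlgebra.basis (Fin 2 → ℤ) ℂ).coord 0

variable {𝔤 : Type*} [LieRing 𝔤] [LieAlgebra ℂ 𝔤]

/-- A nondegenerate symmetric invariant bilinear form on `𝔤`. -/
structure InvForm (𝔤 : Type*) [LieRing 𝔤] [LieAlgebra ℂ 𝔤] where
  form : LinearMap.BilinForm ℂ 𝔤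
  symm : form.IsSymm
  invariant : form.lieInvariant 𝔤
  nondegenerate : form.Nondegenerate

/-- The `2`-loop algebra `𝔤 ⊗ ℂ[t₁^{±1}, t₂^{±1}]`, with the bracket `[x a, y b] = [x, y] a b`. -/
def Loop₂ (𝔤 : Type*) [LieRing 𝔤] [LieAlgebra ℂ 𝔤] : Type _ :=
  LieAlgebra.loopAlgebra ℂ (Fin 2 → ℤ) 𝔤

instance : LieRing (Loop₂ 𝔤) :=
  inferInstanceAs (LieRing (LieAlgebra.loopAlgebra ℂ (Fin 2 → ℤ) 𝔤))

instance : LieAlgebra ℂ (Loop₂ 𝔤) :=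
  inferInstanceAs (LieAlgebra ℂ (LieAlgebra.loopAlgebra ℂ (Fin 2 → ℤ) 𝔤))

/-- The element `x(m) = x ⊗ t₁^{m 0} t₂^{m 1}` of the `2`-loop algebra. -/
def mono (m : Fin 2 → ℤ) : 𝔤 →ₗ[ℂ] Loop₂ 𝔤 :=
  TensorProduct.mk ℂ Laurent₂ 𝔤 (AddMonoidAlgebra.single m 1)

/-- The derivation `x(m₁, m₂) ↦ m_i x(m₁, m₂)` of the `2`-loop algebra. -/
def loopDeg (i : Fin 2) : Loop₂ 𝔤 →ₗ[ℂ] Loop₂ 𝔤 :=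
  ((degLaurent i).rTensor 𝔤 : Laurent₂ ⊗[ℂ] 𝔤 →ₗ[ℂ] Laurent₂ ⊗[ℂ] 𝔤)

/-- The pairing `(x(m), y(n)) ↦ (x|y) δ_{m+n,0}` on the `2`-loop algebra. -/
def loopForm (B : InvForm 𝔤) : LinearMap.BilinForm ℂ (Loop₂ 𝔤) :=
  (LinearMap.BilinForm.tmul ((LinearMap.mul ℂ Laurent₂).compr₂ constCoeff) B.form :
    LinearMap.BilinForm ℂ (Laurent₂ ⊗[ℂ] 𝔤))

/-- The derivation `d₀ · (t₁ ∂/∂t₁) + d₁ · (t₂ ∂/∂t₂)` of the `2`-loop algebra. -/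
def loopDer (d : Fin 2 → ℂ) : Loop₂ 𝔤 →ₗ[ℂ] Loop₂ 𝔤 := ∑ i, d i • loopDeg i

lemma degLaurent_single (i : Fin 2) (m : Fin 2 → ℤ) (r : ℂ) :
    degLaurent i (AddMonoidAlgebra.single m r) = AddMonoidAlgebra.single m ((m i : ℂ) * r) := by
  have h : (AddMonoidAlgebra.single m r : Laurent₂) =
      r • AddMonoidAlgebra.basis (Fin 2 → ℤ) ℂ m := by simp
  rw [h, map_smul, degLaurent, Module.Basis.constr_basis]
  simp [mul_comm]

lemma constCoeff_single (m : Fin 2 → ℤ) (r : ℂ) :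
    constCoeff (AddMonoidAlgebra.single m r) = if m = 0 then r else 0 := by
  have h : (AddMonoidAlgebra.single m r : Laurent₂) =
      r • AddMonoidAlgebra.basis (Fin 2 → ℤ) ℂ m := by simp
  rw [h, map_smul, constCoeff, Module.Basis.coord_apply, Module.Basis.repr_self]
  simp [Finsupp.single_apply]

lemma loopDeg_mono (i : Fin 2) (m : Fin 2 → ℤ) (x : 𝔤) :
    loopDeg i (mono m x) = (m i : ℂ) • mono m x := by
  change (degLaurent i).rTensor 𝔤 (AddMonoidAlgebra.single m 1 ⊗ₜ[ℂ] x) =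
    (m i : ℂ) • (AddMonoidAlgebra.single m (1 : ℂ) ⊗ₜ[ℂ] x)
  simp [degLaurent_single, TensorProduct.smul_tmul']

lemma loopForm_mono (B : InvForm 𝔤) (m n : Fin 2 → ℤ) (x y : 𝔤) :
    loopForm B (mono m x) (mono n y) = if m + n = 0 then B.form x y else 0 := by
  change LinearMap.BilinForm.tmul ((LinearMap.mul ℂ Laurent₂).compr₂ constCoeff) B.form
    (AddMonoidAlgebra.single m 1 ⊗ₜ[ℂ] x) (AddMonoidAlgebra.single n 1 ⊗ₜ[ℂ] y) = _
  simp [AddMonoidAlgebra.single_mul_single, constCoeff_single]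

lemma mono_lie (m n : Fin 2 → ℤ) (x y : 𝔤) : ⁅mono m x, mono n y⁆ = mono (m + n) ⁅x, y⁆ := by
  change ((AddMonoidAlgebra.single m 1 * AddMonoidAlgebra.single n 1 : Laurent₂) ⊗ₜ[ℂ] ⁅x, y⁆ :
    Laurent₂ ⊗[ℂ] 𝔤) = (AddMonoidAlgebra.single (m + n) 1 : Laurent₂) ⊗ₜ[ℂ] ⁅x, y⁆
  rw [AddMonoidAlgebra.single_mul_single, one_mul]

/-- Induction on the elements of the `2`-loop algebra. -/
@[elab_as_elim]
lemma loop_induction {p : Loop₂ 𝔤 → Prop} (f : Loop₂ 𝔤) (h0 : p 0)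
    (h1 : ∀ m x, p (mono m x)) (hadd : ∀ f g, p f → p g → p (f + g)) : p f := by
  refine TensorProduct.induction_on (motive := p) f h0 (fun a x => ?_) hadd
  induction a using AddMonoidAlgebra.induction_linear with
  | zero => rw [TensorProduct.zero_tmul]; exact h0
  | add a b ha hb => rw [TensorProduct.add_tmul]; exact hadd _ _ ha hb
  | single m r =>
    have h : (AddMonoidAlgebra.single m r : Laurent₂) ⊗ₜ[ℂ] x =
        (AddMonoidAlgebra.single m 1 : Laurent₂) ⊗ₜ[ℂ] (r • x) := by
      rw [← TensorProduct.smul_tmul]; simp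
    rw [h]
    exact h1 m (r • x)

lemma loopDeg_lie (i : Fin 2) (f g : Loop₂ 𝔤) :
    loopDeg i ⁅f, g⁆ = ⁅loopDeg i f, g⁆ + ⁅f, loopDeg i g⁆ := by
  induction f using loop_induction with
  | h0 => simp
  | hadd f f' hf hf' => simp only [add_lie, map_add, hf, hf']; abel
  | h1 m x =>
    induction g using loop_induction with
    | h0 => simp
    | hadd g g' hg hg' => simp only [lie_add, map_add, hg, hg']; abel
    | h1 n y =>
      simp only [loopDeg_mono, mono_lie, smul_lie, lie_smul, ← add_smul]
      simp

lemma loopDeg_comm (i j : Fin 2) (f : Loop₂ 𝔤) :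
    loopDeg i (loopDeg j f) = loopDeg j (loopDeg i f) := by
  induction f using loop_induction with
  | h0 => simp
  | hadd f f' hf hf' => simp only [map_add, hf, hf']
  | h1 m x => simp only [loopDeg_mono, map_smul, smul_smul, mul_comm]

lemma loopForm_symm (B : InvForm 𝔤) (f g : Loop₂ 𝔤) : loopForm B f g = loopForm B g f := by
  induction f using loop_induction with
  | h0 => simp
  | hadd f f' hf hf' => simp only [map_add, LinearMap.add_apply, hf, hf']
  | h1 m x =>
    induction g using loop_induction with
    | h0 => simp
    | hadd g g' hg hg' => simp only [map_add, LinearMap.add_apply, hg, hg']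
    | h1 n y =>
      rw [loopForm_mono, loopForm_mono, add_comm n m, B.symm.eq x y]

lemma loopForm_lie (B : InvForm 𝔤) (f g h : Loop₂ 𝔤) :
    loopForm B ⁅f, g⁆ h = loopForm B f ⁅g, h⁆ := by
  induction f using loop_induction with
  | h0 => simp
  | hadd f f' hf hf' => simp only [add_lie, map_add, LinearMap.add_apply, hf, hf']
  | h1 m x =>
    induction g using loop_induction with
    | h0 => simp
    | hadd g g' hg hg' => simp only [add_lie, lie_add, map_add, LinearMap.add_apply, hg, hg']
    | h1 n y =>
      induction h using loop_induction with
      | h0 => simp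
      | hadd g g' hg hg' => simp only [lie_add, map_add, hg, hg']
      | h1 k z =>
        have h : B.form ⁅x, y⁆ z = B.form x ⁅y, z⁆ := by
          rw [← lie_skew, map_neg, LinearMap.neg_apply, B.invariant, neg_neg]
        simp only [mono_lie, loopForm_mono, h, add_assoc]

lemma loopForm_deg (B : InvForm 𝔤) (i : Fin 2) (f g : Loop₂ 𝔤) :
    loopForm B (loopDeg i f) g = -loopForm B f (loopDeg i g) := by
  induction f using loop_induction with
  | h0 => simp
  | hadd f f' hf hf' => simp only [map_add, LinearMap.add_apply, hf, hf']; ring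
  | h1 m x =>
    induction g using loop_induction with
    | h0 => simp
    | hadd g g' hg hg' => simp only [map_add, hg, hg']; ring
    | h1 n y =>
      simp only [loopDeg_mono, map_smul, LinearMap.smul_apply, loopForm_mono, smul_eq_mul]
      split_ifs with h
      · rw [eq_neg_of_add_eq_zero_left h]; simp
      · simp

lemma loopDer_apply (d : Fin 2 → ℂ) (f : Loop₂ 𝔤) : loopDer d f = ∑ i, d i • loopDeg i f := by
  simp [loopDer]

lemma loopDer_add (d d' : Fin 2 → ℂ) (f : Loop₂ 𝔤) :
    loopDer (d + d') f = loopDer d f + loopDer d' f := by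
  simp [loopDer_apply, add_smul, Finset.sum_add_distrib]

lemma loopDer_zero (f : Loop₂ 𝔤) : loopDer 0 f = 0 := by
  simp [loopDer_apply]

lemma loopDer_smul (r : ℂ) (d : Fin 2 → ℂ) (f : Loop₂ 𝔤) :
    loopDer (r • d) f = r • loopDer d f := by
  simp [loopDer_apply, smul_smul]

lemma loopDer_lie (d : Fin 2 → ℂ) (f g : Loop₂ 𝔤) :
    loopDer d ⁅f, g⁆ = ⁅loopDer d f, g⁆ + ⁅f, loopDer d g⁆ := by
  simp only [loopDer_apply, Fin.sum_univ_two, loopDeg_lie, add_lie, lie_add, smul_lie, lie_smul,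
    smul_add]
  abel

lemma loopDeg_loopDer (i : Fin 2) (d : Fin 2 → ℂ) (f : Loop₂ 𝔤) :
    loopDeg i (loopDer d f) = loopDer d (loopDeg i f) := by
  simp only [loopDer_apply, Fin.sum_univ_two, map_add, map_smul, loopDeg_comm i]

lemma loopDer_comm (d d' : Fin 2 → ℂ) (f : Loop₂ 𝔤) :
    loopDer d (loopDer d' f) = loopDer d' (loopDer d f) := by
  rw [loopDer_apply d, loopDer_apply d]
  simp only [Fin.sum_univ_two, map_add, map_smul, loopDeg_loopDer]

lemma loopForm_der (B : InvForm 𝔤) (d : Fin 2 → ℂ) (f g : Loop₂ 𝔤) :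
    loopForm B (loopDer d f) g = -loopForm B f (loopDer d g) := by
  simp only [loopDer_apply, Fin.sum_univ_two, map_add, map_smul, LinearMap.add_apply,
    LinearMap.smul_apply, loopForm_deg, smul_eq_mul]
  ring

/-- The coefficient in `𝔤` of `t₁^{m 0} t₂^{m 1}`. -/
def coeff (m : Fin 2 → ℤ) : Loop₂ 𝔤 →ₗ[ℂ] 𝔤 :=
  ((Finsupp.lapply m).comp (LieAlgebra.LoopAlgebra.toFinsupp ℂ (Fin 2 → ℤ) 𝔤).toLinearMap :
    LieAlgebra.loopAlgebra ℂ (Fin 2 → ℤ) 𝔤 →ₗ[ℂ] 𝔤)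

lemma coeff_mono (m n : Fin 2 → ℤ) (x : 𝔤) : coeff m (mono n x) = if n = m then x else 0 := by
  change LieAlgebra.LoopAlgebra.toFinsupp ℂ (Fin 2 → ℤ) 𝔤
    (AddMonoidAlgebra.single n 1 ⊗ₜ[ℂ] x) m = _
  rw [LieAlgebra.LoopAlgebra.toFinsupp_single_tmul, Finsupp.single_apply]

lemma eq_zero_of_coeff (f : Loop₂ 𝔤) (h : ∀ m, coeff m f = 0) : f = 0 :=
  (LinearEquiv.map_eq_zero_iff (LieAlgebra.LoopAlgebra.toFinsupp ℂ (Fin 2 → ℤ) 𝔤)).mp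
    (Finsupp.ext h)

lemma coeff_mono_zero_lie (m : Fin 2 → ℤ) (x : 𝔤) (f : Loop₂ 𝔤) :
    coeff m ⁅mono 0 x, f⁆ = ⁅x, coeff m f⁆ := by
  induction f using loop_induction with
  | h0 => simp
  | hadd f g hf hg => simp only [lie_add, map_add, hf, hg]
  | h1 n y =>
    rw [mono_lie, zero_add, coeff_mono, coeff_mono]
    split_ifs <;> simp

lemma coeff_loopDer (m : Fin 2 → ℤ) (d : Fin 2 → ℂ) (f : Loop₂ 𝔤) :
    coeff m (loopDer d f) = (∑ i, d i * m i) • coeff m f := by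
  induction f using loop_induction with
  | h0 => simp
  | hadd f g hf hg => simp only [map_add, smul_add, hf, hg]
  | h1 n y =>
    simp only [loopDer_apply, loopDeg_mono, smul_smul, ← Finset.sum_smul, map_smul, coeff_mono]
    split_ifs with h
    · rw [h]
    · simp

/-- The extended double affine Lie algebra
`𝔗 = 𝔤 ⊗ ℂ[t₁^{±1}, t₂^{±1}] ⊕ ℂc₁ ⊕ ℂc₂ ⊕ ℂd₁ ⊕ ℂd₂`: a triple `(f, c, d)` stands for
`f + c 0 • c₁ + c 1 • c₂ + d 0 • d₁ + d 1 • d₂`. -/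
def Toroidal (_B : InvForm 𝔤) : Type _ := Loop₂ 𝔤 × (Fin 2 → ℂ) × (Fin 2 → ℂ)

namespace Toroidal

variable (B : InvForm 𝔤)

instance : AddCommGroup (Toroidal B) :=
  inferInstanceAs (AddCommGroup (Loop₂ 𝔤 × (Fin 2 → ℂ) × (Fin 2 → ℂ)))

instance : Module ℂ (Toroidal B) :=
  inferInstanceAs (Module ℂ (Loop₂ 𝔤 × (Fin 2 → ℂ) × (Fin 2 → ℂ)))

variable {B}

/-- The component in `𝔤 ⊗ ℂ[t₁^{±1}, t₂^{±1}]`. -/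
def loop : Toroidal B →ₗ[ℂ] Loop₂ 𝔤 :=
  LinearMap.fst ℂ (Loop₂ 𝔤) ((Fin 2 → ℂ) × (Fin 2 → ℂ))

/-- The coefficients of `c₁`, `c₂`. -/
def cen : Toroidal B →ₗ[ℂ] (Fin 2 → ℂ) :=
  (LinearMap.fst ℂ (Fin 2 → ℂ) (Fin 2 → ℂ)).comp (LinearMap.snd ℂ (Loop₂ 𝔤) _)

/-- The coefficients of `d₁`, `d₂`. -/
def der : Toroidal B →ₗ[ℂ] (Fin 2 → ℂ) :=
  (LinearMap.snd ℂ (Fin 2 → ℂ) (Fin 2 → ℂ)).comp (LinearMap.snd ℂ (Loop₂ 𝔤) _)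

/-- The element `f + c 0 • c₁ + c 1 • c₂ + d 0 • d₁ + d 1 • d₂`. -/
def mk (B : InvForm 𝔤) (f : Loop₂ 𝔤) (c d : Fin 2 → ℂ) : Toroidal B := (f, c, d)

@[simp] lemma loop_mk (f : Loop₂ 𝔤) (c d : Fin 2 → ℂ) : (mk B f c d).loop = f := rfl
@[simp] lemma cen_mk (f : Loop₂ 𝔤) (c d : Fin 2 → ℂ) : (mk B f c d).cen = c := rfl
@[simp] lemma der_mk (f : Loop₂ 𝔤) (c d : Fin 2 → ℂ) : (mk B f c d).der = d := rfl

@[ext] lemma ext {x y : Toroidal B} (h₁ : x.loop = y.loop) (h₂ : x.cen = y.cen)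
    (h₃ : x.der = y.der) : x = y :=
  Prod.ext h₁ (Prod.ext h₂ h₃)

/-- The bracket of `𝔗`: `c₁`, `c₂` are central, `[d₁, d₂] = 0`, `[d_i, x(m)] = m_i x(m)` and
`[x(m), y(n)] = [x, y](m + n) + (x|y) δ_{m+n,0} (m₁ c₁ + m₂ c₂)`. -/
instance : Bracket (Toroidal B) (Toroidal B) where
  bracket x y := mk B (⁅x.loop, y.loop⁆ + loopDer x.der y.loop - loopDer y.der x.loop)
    (fun i => loopForm B (loopDeg i x.loop) y.loop) 0

@[simp] lemma loop_lie (x y : Toroidal B) :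
    (⁅x, y⁆ : Toroidal B).loop =
      ⁅x.loop, y.loop⁆ + loopDer x.der y.loop - loopDer y.der x.loop := rfl

@[simp] lemma cen_lie (x y : Toroidal B) (i : Fin 2) :
    (⁅x, y⁆ : Toroidal B).cen i = loopForm B (loopDeg i x.loop) y.loop := rfl

@[simp] lemma der_lie (x y : Toroidal B) : (⁅x, y⁆ : Toroidal B).der = 0 := rfl

instance : LieRing (Toroidal B) where
  add_lie x y z := by
    ext i
    · simp only [loop_lie, map_add, add_lie, loopDer_add]; abel
    · simp
    · simp
  lie_add x y z := by
    ext i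
    · simp only [loop_lie, map_add, lie_add, loopDer_add]; abel
    · simp
    · simp
  lie_self x := by
    ext i
    · simp
    · have h := loopForm_deg B i x.loop x.loop
      rw [loopForm_symm B x.loop] at h
      have h' : loopForm B (loopDeg i x.loop) x.loop = 0 := by
        linear_combination (1 / 2 : ℂ) * h
      simpa using h'
    · simp
  leibniz_lie x y z := by
    ext i
    · simp only [loop_lie, map_add, map_sub, lie_add, lie_sub, add_lie, sub_lie, der_lie,
        loopDer_lie, loopDer_zero, leibniz_lie x.loop y.loop z.loop, loopDer_comm x.der y.der,
        loopDer_comm z.der]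
      rw [← lie_skew (loopDer z.der x.loop) y.loop]
      abel
    · simp only [cen_lie, loop_lie, map_add, map_sub, Pi.add_apply, LinearMap.add_apply,
        LinearMap.sub_apply, loopDeg_lie, loopDeg_loopDer]
      have e1 := loopForm_lie B (loopDeg i x.loop) y.loop z.loop
      have e2 : loopForm B ⁅x.loop, loopDeg i y.loop⁆ z.loop
          = -loopForm B (loopDeg i y.loop) ⁅x.loop, z.loop⁆ := by
        rw [← lie_skew, map_neg, LinearMap.neg_apply, loopForm_lie]
      have e3 := loopForm_der B y.der (loopDeg i x.loop) z.loop
      have e4 := loopForm_der B x.der (loopDeg i y.loop) z.loop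
      have e5 := loopForm_der B z.der (loopDeg i x.loop) y.loop
      have e6 := loopForm_deg B i y.loop (loopDer z.der x.loop)
      rw [loopForm_symm B y.loop, loopDeg_loopDer] at e6
      linear_combination -e1 - e2 + e3 - e4 - e5 + e6
    · simp

instance : LieAlgebra ℂ (Toroidal B) where
  lie_smul r x y := by
    ext i
    · simp [loopDer_smul, smul_sub]
    · simp
    · simp

end Toroidal

/-! ### Weights -/

section Weights

variable (H : LieSubalgebra ℂ 𝔤)

/-- The Cartan subalgebra `𝔥̂ = 𝔥 ⊕ ℂc₁ ⊕ ℂc₂ ⊕ ℂd₁ ⊕ ℂd₂`, as a vector space. -/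
abbrev Cartan : Type _ := H × (Fin 2 → ℂ) × (Fin 2 → ℂ)

variable {H}

/-- The inclusion of `𝔥̂` into `𝔗`. -/
def Cartan.incl (B : InvForm 𝔤) : Cartan H →ₗ[ℂ] Toroidal B where
  toFun h := Toroidal.mk B (mono 0 (h.1 : 𝔤)) h.2.1 h.2.2
  map_add' h h' := by ext <;> simp
  map_smul' r h := by ext <;> simp

@[simp] lemma loop_incl (B : InvForm 𝔤) (h : Cartan H) :
    (Cartan.incl B h).loop = mono 0 (h.1 : 𝔤) := rfl
@[simp] lemma cen_incl (B : InvForm 𝔤) (h : Cartan H) : (Cartan.incl B h).cen = h.2.1 := rfl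
@[simp] lemma der_incl (B : InvForm 𝔤) (h : Cartan H) : (Cartan.incl B h).der = h.2.2 := rfl

lemma loopDeg_mono_zero (i : Fin 2) (x : 𝔤) : loopDeg i (mono 0 x) = 0 := by
  simp [loopDeg_mono]

lemma loop_incl_lie (B : InvForm 𝔤) (h : Cartan H) (x : Toroidal B) :
    (⁅Cartan.incl B h, x⁆ : Toroidal B).loop =
      ⁅mono 0 (h.1 : 𝔤), x.loop⁆ + loopDer h.2.2 x.loop := by
  simp [loopDer_apply, loopDeg_mono_zero]

lemma cen_incl_lie (B : InvForm 𝔤) (h : Cartan H) (x : Toroidal B) :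
    (⁅Cartan.incl B h, x⁆ : Toroidal B).cen = 0 := by
  ext i
  simp [loopDeg_mono_zero]

/-- The weight space `V_μ = {v | h v = μ(h) v for all h ∈ 𝔥̂}` of a `𝔗`-module `V`. -/
def wtSpace (B : InvForm 𝔤) (V : Type*) [AddCommGroup V] [Module ℂ V]
    [LieRingModule (Toroidal B) V] [LieModule ℂ (Toroidal B) V]
    (μ : Module.Dual ℂ (Cartan H)) : Submodule ℂ V where
  carrier := {v | ∀ h : Cartan H, ⁅Cartan.incl B h, v⁆ = μ h • v}
  add_mem' {v w} hv hw h := by rw [lie_add, hv h, hw h, smul_add]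
  zero_mem' h := by simp
  smul_mem' r v hv h := by rw [lie_smul, hv h, smul_comm]

/-- The root space `𝔗_β`. -/
abbrev rtSpace (B : InvForm 𝔤) (β : Module.Dual ℂ (Cartan H)) : Submodule ℂ (Toroidal B) :=
  wtSpace B (Toroidal B) β

lemma lie_mem_rtSpace {B : InvForm 𝔤} {β γ : Module.Dual ℂ (Cartan H)} {x y : Toroidal B}
    (hx : x ∈ rtSpace B β) (hy : y ∈ rtSpace B γ) : ⁅x, y⁆ ∈ rtSpace B (β + γ) := by
  intro h
  rw [leibniz_lie, hx h, hy h, smul_lie, lie_smul, ← add_smul, LinearMap.add_apply]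

/-- The root system of `𝔗`: the nonzero `β ∈ 𝔥̂^*` with `𝔗_β ≠ 0`. -/
def rtSystem (B : InvForm 𝔤) : Set (Module.Dual ℂ (Cartan H)) :=
  {β | β ≠ 0 ∧ rtSpace B β ≠ ⊥}

/-- The functional `δ_{i+1}` on `𝔥̂`, dual to `d_{i+1}` and zero on `𝔥`, `c₁`, `c₂`. -/
def delta (i : Fin 2) : Module.Dual ℂ (Cartan H) :=
  (LinearMap.proj i).comp ((LinearMap.snd ℂ _ _).comp (LinearMap.snd ℂ _ _))

/-- A functional on `𝔥`, extended to `𝔥̂` by zero on `c₁`, `c₂`, `d₁`, `d₂`. -/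
def extendDual (α : Module.Dual ℂ H) : Module.Dual ℂ (Cartan H) := α.comp (LinearMap.fst ℂ _ _)

/-- The sum of the root spaces `𝔗_β`, `β ∈ S`. -/
def rtSum (B : InvForm 𝔤) (S : Set (Module.Dual ℂ (Cartan H))) : Submodule ℂ (Toroidal B) :=
  ⨆ β ∈ S, rtSpace B β

lemma rtSpace_le_rtSum {B : InvForm 𝔤} {S : Set (Module.Dual ℂ (Cartan H))}
    {β : Module.Dual ℂ (Cartan H)} (hβ : β ∈ S) : rtSpace B β ≤ rtSum B S :=
  le_iSup₂_of_le β hβ le_rfl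

lemma rtSum_induction {B : InvForm 𝔤} {S : Set (Module.Dual ℂ (Cartan H))}
    {p : Toroidal B → Prop} {x : Toroidal B} (hx : x ∈ rtSum B S)
    (h1 : ∀ β ∈ S, ∀ y ∈ rtSpace B β, p y) (h0 : p 0)
    (hadd : ∀ y z, p y → p z → p (y + z)) : p x := by
  rw [rtSum, iSup_subtype'] at hx
  exact Submodule.iSup_induction _ (motive := p) hx (fun β y hy => h1 β β.2 y hy) h0 hadd

lemma incl_lie_mem_rtSum {B : InvForm 𝔤} {S : Set (Module.Dual ℂ (Cartan H))} (h : Cartan H)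
    {x : Toroidal B} (hx : x ∈ rtSum B S) : ⁅Cartan.incl B h, x⁆ ∈ rtSum B S := by
  refine rtSum_induction (p := fun x => ⁅Cartan.incl B h, x⁆ ∈ rtSum B S) hx
    (fun β hβ y hy => ?_) (by simp) (fun y z hy hz => ?_)
  · rw [hy h]
    exact Submodule.smul_mem _ _ (rtSpace_le_rtSum hβ hy)
  · rw [lie_add]
    exact add_mem hy hz

lemma lie_mem_rtSum {B : InvForm 𝔤} {S : Set (Module.Dual ℂ (Cartan H))}
    (hS : ∀ β ∈ S, ∀ γ ∈ S, rtSpace B (β + γ) ≠ ⊥ → β + γ ∈ S)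
    {x y : Toroidal B} (hx : x ∈ rtSum B S) (hy : y ∈ rtSum B S) : ⁅x, y⁆ ∈ rtSum B S := by
  refine rtSum_induction (p := fun x => ⁅x, y⁆ ∈ rtSum B S) hx
    (fun β hβ x hx => ?_) (by simp) (fun x x' hx hx' => ?_)
  · refine rtSum_induction (p := fun y => ⁅x, y⁆ ∈ rtSum B S) hy
      (fun γ hγ y hy => ?_) (by simp) (fun y y' hy hy' => ?_)
    · have h := lie_mem_rtSpace hx hy
      by_cases hb : rtSpace B (β + γ) = ⊥
      · rw [hb, Submodule.mem_bot] at h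
        rw [h]
        exact zero_mem _
      · exact rtSpace_le_rtSum (hS β hβ γ hγ hb) h
    · rw [lie_add]
      exact add_mem hy hy'
  · rw [add_lie]
    exact add_mem hx hx'

end Weights

/-! ### The closed subset `𝓘` and the imaginary Borel subalgebra -/

section Borel

open LieAlgebra.IsKilling

variable [FiniteDimensional ℂ 𝔤] [LieAlgebra.IsSimple ℂ 𝔤]
variable {H : LieSubalgebra ℂ 𝔤} [H.IsCartanSubalgebra]
variable (b : (rootSystem H).Base) (θ : H.root)

/-- The index set `{-1, 0, 1, …, s}` of the simple roots of `𝔗`: `none` is `-1`, `some none` is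
`0`, and the rest is the index set of the simple roots of `𝔤`. -/
abbrev SimpleIdx : Type _ := Option (Option b.support)

/-- The simple roots `α_{-1} = δ₂ - θ`, `α₀ = δ₁ - θ`, `α₁, …, α_s` of `𝔗`. -/
def simpleRt : SimpleIdx b → Module.Dual ℂ (Cartan H)
  | none => delta 1 - extendDual ((rootSystem H).root θ)
  | some none => delta 0 - extendDual ((rootSystem H).root θ)
  | some (some i) => extendDual ((rootSystem H).root i)

/-- The element of `𝔥` at which the simple root `α_j` of `𝔤` takes the value `δ_{ij}`. -/
def coweight (i : b.support) : H :=
  (Module.evalEquiv ℂ H).symm (b.toWeightBasis.coord i)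

/-- The elements `α_i^* ∈ 𝔥̂` with `α_i^*(α_j) = δ_{ij}` for `i, j = -1, 0, …, s`
(see `simpleRt_dualElt`). -/
def dualElt : SimpleIdx b → Cartan H
  | none => (0, 0, Pi.single 1 1)
  | some none => (0, 0, Pi.single 0 1)
  | some (some i) => (coweight b i, 0, fun _ => (rootSystem H).root θ (coweight b i))

/-- `φ = ∑_{i=0}^s α_i^* - ht(θ) α_{-1}^*`. -/
def phi : Cartan H :=
  ∑ i : Option b.support, dualElt b θ (some i) - (b.height θ : ℂ) • dualElt b θ none

/-- `𝓘 = {β a root of 𝔗 | φ(β) > 0} ∪ {n δ₂ | n ≥ 1}`. The values of `φ` at roots are integers. -/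
def posSet (B : InvForm 𝔤) : Set (Module.Dual ℂ (Cartan H)) :=
  {β | β ∈ rtSystem B ∧ 0 < (β (phi b θ)).re} ∪ {β | ∃ n : ℕ, 0 < n ∧ β = n • delta 1}

lemma coweight_apply (i : b.support) (f : Module.Dual ℂ H) :
    f (coweight b i) = b.toWeightBasis.repr f i := by
  rw [coweight, Module.apply_evalEquiv_symm_apply]; rfl

open Classical in
lemma root_coweight (i j : b.support) :
    (rootSystem H).root j (coweight b i) = if i = j then 1 else 0 := by
  rw [coweight_apply, b.toWeightBasis_repr_root]
  simp [Finsupp.single_apply, eq_comm]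

open Classical in
lemma simpleRt_dualElt (i j : SimpleIdx b) :
    simpleRt b θ j (dualElt b θ i) = if i = j then 1 else 0 := by
  rcases i with _ | _ | i <;> rcases j with _ | _ | j <;>
    simp only [simpleRt, dualElt, delta, extendDual] <;> simp
  exact root_coweight b i j

lemma sum_root_coweight (α : H.root) :
    ∑ i : b.support, (rootSystem H).root α (coweight b i) = b.height α := by
  obtain ⟨f, -, -, hf⟩ := b.exists_root_eq_sum_int α
  rw [b.height_eq_sum hf, hf, ← Finset.sum_coe_sort b.support f, Int.cast_sum]
  refine Finset.sum_congr rfl fun i _ => ?_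
  rw [← Finset.sum_coe_sort b.support (fun j => f j • (rootSystem H).root j),
    LinearMap.sum_apply, Finset.sum_eq_single i]
  · have := root_coweight b i i
    simp [-rootSystem_root_apply, this]
  · intro j _ hj
    have := root_coweight b i j
    rw [if_neg (Ne.symm hj)] at this
    simp [-rootSystem_root_apply, this]
  · simp

lemma delta_phi : delta 1 (phi b θ) = 0 := by
  have h := sum_root_coweight b θ
  simp only [phi, Fintype.sum_option, map_sub, map_add, map_sum, map_smul]
  simp only [dualElt, delta, LinearMap.comp_apply, LinearMap.snd_apply, LinearMap.proj_apply]
  rw [h]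
  simp

lemma posSet_cases {B : InvForm 𝔤} {β : Module.Dual ℂ (Cartan H)} (hβ : β ∈ posSet b θ B) :
    0 < (β (phi b θ)).re ∨ ∃ n : ℕ, 0 < n ∧ β = n • delta 1 :=
  hβ.imp And.right id

lemma ne_zero_of_mem_posSet {B : InvForm 𝔤} {β : Module.Dual ℂ (Cartan H)}
    (hβ : β ∈ posSet b θ B) : β ≠ 0 := by
  rcases hβ with hβ | ⟨n, hn, rfl⟩
  · exact hβ.1.1
  · intro h
    have := LinearMap.congr_fun h ((0, 0, fun _ => 1) : Cartan H)
    simp [delta] at this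
    omega

lemma add_ne_zero_of_mem_posSet {B : InvForm 𝔤} {β γ : Module.Dual ℂ (Cartan H)}
    (hβ : β ∈ posSet b θ B) (hγ : γ ∈ posSet b θ B) : β + γ ≠ 0 := by
  have key : 0 < ((β + γ) (phi b θ)).re → β + γ ≠ 0 := fun hp h0 => by
    rw [h0] at hp
    simp at hp
  rcases posSet_cases b θ hβ with h1 | ⟨n, hn, rfl⟩ <;>
    rcases posSet_cases b θ hγ with h2 | ⟨k, hk, rfl⟩
  · exact key (by rw [LinearMap.add_apply, Complex.add_re]; linarith)
  · exact key (by simpa [delta_phi] using h1)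
  · exact key (by simpa [delta_phi] using h2)
  · rw [← add_smul]
    exact ne_zero_of_mem_posSet b θ (B := B) (Or.inr ⟨n + k, by omega, rfl⟩)

lemma posSet_closed (B : InvForm 𝔤) (β : Module.Dual ℂ (Cartan H)) (hβ : β ∈ posSet b θ B)
    (γ : Module.Dual ℂ (Cartan H)) (hγ : γ ∈ posSet b θ B) (h : rtSpace B (β + γ) ≠ ⊥) :
    β + γ ∈ posSet b θ B := by
  have key : 0 < ((β + γ) (phi b θ)).re → β + γ ∈ posSet b θ B := fun hp =>
    Or.inl ⟨⟨fun h0 => by rw [h0] at hp; simp at hp, h⟩, hp⟩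
  rcases posSet_cases b θ hβ with h1 | ⟨n, hn, rfl⟩ <;>
    rcases posSet_cases b θ hγ with h2 | ⟨k, hk, rfl⟩
  · exact key (by rw [LinearMap.add_apply, Complex.add_re]; linarith)
  · exact key (by simpa [delta_phi] using h1)
  · exact key (by simpa [delta_phi] using h2)
  · exact Or.inr ⟨n + k, by omega, by rw [add_smul]⟩

lemma rtSpace_neg_ne_bot {B : InvForm 𝔤} {β : Module.Dual ℂ (Cartan H)} (hβ : β ≠ 0)
    (h : rtSpace B β ≠ ⊥) : rtSpace B (-β) ≠ ⊥ := by
  obtain ⟨x, hx, hx0⟩ := Submodule.exists_mem_ne_zero_of_ne_bot h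
  obtain ⟨k, hk⟩ : ∃ k, β k ≠ 0 := by
    by_contra! hc
    exact hβ (LinearMap.ext hc)
  have hcen : x.cen = 0 := by
    have := congrArg Toroidal.cen (hx k)
    rw [cen_incl_lie, map_smul] at this
    exact (smul_eq_zero.mp this.symm).resolve_left hk
  have hder : x.der = 0 := by
    have := congrArg Toroidal.der (hx k)
    rw [Toroidal.der_lie, map_smul] at this
    exact (smul_eq_zero.mp this.symm).resolve_left hk
  obtain ⟨m, hm⟩ : ∃ m, coeff m x.loop ≠ 0 := by
    by_contra! hc
    exact hx0 (Toroidal.ext (eq_zero_of_coeff _ hc) hcen hder)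
  have hw (k : Cartan H) : ⁅(k.1 : 𝔤), coeff m x.loop⁆ =
      (β k - ∑ i, k.2.2 i * m i) • coeff m x.loop := by
    have := congrArg (coeff m) (congrArg Toroidal.loop (hx k))
    rw [loop_incl_lie, map_add, coeff_mono_zero_lie, coeff_loopDer, map_smul, map_smul] at this
    rw [sub_smul, ← this, add_sub_cancel_right]
  let α : LieModule.Weight ℂ H 𝔤 :=
    { toFun := fun k => β (k, 0, 0)
      genWeightSpace_ne_bot' := by
        intro hc
        have : coeff m x.loop ∈ LieModule.genWeightSpace 𝔤 (fun k : H => β (k, 0, 0)) := by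
          rw [LieModule.mem_genWeightSpace]
          intro k
          refine ⟨1, ?_⟩
          have := hw (k, 0, 0)
          simp only [Pi.zero_apply, zero_mul, Finset.sum_const_zero, sub_zero] at this
          simp [← this]
        rw [hc] at this
        exact hm (by simpa using this) }
  obtain ⟨z, hz0, hz⟩ := LieModule.exists_forall_lie_eq_smul ℂ H 𝔤 (-α)
  have hβk (k : Cartan H) : β k = α k.1 + ∑ i, k.2.2 i * m i := by
    have h1 := hw k
    have h2 := hw (k.1, 0, 0)
    simp only [Pi.zero_apply, zero_mul, Finset.sum_const_zero, sub_zero] at h2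
    rw [h1] at h2
    have h3 : β k - ∑ i, k.2.2 i * m i = α k.1 := smul_left_injective ℂ hm h2
    linear_combination h3
  have hmem : Toroidal.mk B (mono (-m) z) 0 0 ∈ rtSpace B (-β) := by
    intro k
    have hzk : ⁅(k.1 : 𝔤), z⁆ = -(α k.1) • z := by simpa using hz k.1
    ext i
    · rw [loop_incl_lie, map_smul, Toroidal.loop_mk, mono_lie, zero_add, hzk, loopDer_apply,
        LinearMap.neg_apply, hβk, map_smul]
      simp only [loopDeg_mono, Fin.sum_univ_two, smul_smul, ← add_smul]
      congr 1
      simp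
      ring
    · rw [cen_incl_lie]
      simp
    · simp
  intro hb
  rw [hb, Submodule.mem_bot] at hmem
  have h0 : coeff (-m) (Toroidal.mk B (mono (-m) z) 0 0).loop = 0 := by rw [hmem]; simp
  rw [Toroidal.loop_mk, coeff_mono, if_pos rfl] at h0
  exact hz0 h0

/-- The set `-𝓘`. -/
def negSet (B : InvForm 𝔤) : Set (Module.Dual ℂ (Cartan H)) := {β | -β ∈ posSet b θ B}

lemma negSet_closed (B : InvForm 𝔤) (β : Module.Dual ℂ (Cartan H)) (hβ : β ∈ negSet b θ B)
    (γ : Module.Dual ℂ (Cartan H)) (hγ : γ ∈ negSet b θ B) (h : rtSpace B (β + γ) ≠ ⊥) :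
    β + γ ∈ negSet b θ B := by
  change -(β + γ) ∈ posSet b θ B
  have h0 : β + γ ≠ 0 := fun h0 => add_ne_zero_of_mem_posSet b θ hβ hγ
    (by rw [← neg_add, h0, neg_zero])
  rw [neg_add]
  refine posSet_closed b θ B _ hβ _ hγ ?_
  rw [← neg_add]
  exact rtSpace_neg_ne_bot h0 h

/-- The subalgebra `𝔗_𝓘 = ⨁_{β ∈ 𝓘} 𝔗_β`. -/
def nPos (B : InvForm 𝔤) : LieSubalgebra ℂ (Toroidal B) where
  __ := rtSum B (posSet b θ B)
  lie_mem' hx hy := lie_mem_rtSum (posSet_closed b θ B) hx hy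

/-- The subalgebra `𝔗_{-𝓘} = ⨁_{β ∈ -𝓘} 𝔗_β`. -/
def nNeg (B : InvForm 𝔤) : LieSubalgebra ℂ (Toroidal B) where
  __ := rtSum B (negSet b θ B)
  lie_mem' hx hy := lie_mem_rtSum (negSet_closed b θ B) hx hy

lemma incl_lie_incl (B : InvForm 𝔤) (h k : Cartan H) :
    ⁅Cartan.incl B h, Cartan.incl B k⁆ = 0 := by
  ext i
  · have hk : ⁅(h.1 : 𝔤), (k.1 : 𝔤)⁆ = 0 := by
      rw [← LieSubalgebra.coe_bracket, trivial_lie_zero]; rfl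
    rw [loop_incl_lie, loop_incl, mono_lie, hk]
    simp [loopDer_apply, loopDeg_mono_zero]
  · rw [cen_incl_lie]
    simp
  · simp

lemma lie_mem_nPos_of_mem {B : InvForm 𝔤} {x y : Toroidal B}
    (hx : x ∈ LinearMap.range (Cartan.incl (H := H) B) ⊔ rtSum B (posSet b θ B))
    (hy : y ∈ LinearMap.range (Cartan.incl (H := H) B) ⊔ rtSum B (posSet b θ B)) :
    ⁅x, y⁆ ∈ rtSum B (posSet b θ B) := by
  obtain ⟨_, ⟨h, rfl⟩, x', hx', rfl⟩ := Submodule.mem_sup.mp hx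
  obtain ⟨_, ⟨k, rfl⟩, y', hy', rfl⟩ := Submodule.mem_sup.mp hy
  rw [add_lie, lie_add, lie_add, incl_lie_incl, zero_add, ← lie_skew x']
  exact add_mem (incl_lie_mem_rtSum h hy') (add_mem (neg_mem (incl_lie_mem_rtSum k hx'))
    (lie_mem_rtSum (posSet_closed b θ B) hx' hy'))

/-- The imaginary Borel subalgebra `𝔟_𝓘 = 𝔥̂ ⊕ 𝔗_𝓘`. -/
def borel (B : InvForm 𝔤) : LieSubalgebra ℂ (Toroidal B) where
  __ := LinearMap.range (Cartan.incl (H := H) B) ⊔ rtSum B (posSet b θ B)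
  lie_mem' hx hy := Submodule.mem_sup_right (lie_mem_nPos_of_mem b θ hx hy)

/-- The projection of `𝔤` onto `𝔥` along the root spaces, i.e. along the orthogonal complement of
`𝔥` for the Killing form. -/
def projH (H : LieSubalgebra ℂ 𝔤) [H.IsCartanSubalgebra] : 𝔤 →ₗ[ℂ] H :=
  (cartanEquivDual H).symm.toLinearMap ∘ₗ (H.subtype.dualMap ∘ₗ killingForm ℂ 𝔤)

lemma projH_coe (h : H) : projH H h = h := by
  rw [projH, LinearMap.comp_apply, LinearEquiv.coe_coe, LinearEquiv.symm_apply_eq]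
  rfl

lemma projH_lie (h : H) (x : 𝔤) : projH H ⁅(h : 𝔤), x⁆ = 0 := by
  rw [projH, LinearMap.comp_apply, LinearEquiv.coe_coe, LinearEquiv.symm_apply_eq, map_zero]
  ext k
  have hk : ⁅(h : 𝔤), (k : 𝔤)⁆ = 0 := by
    rw [← LieSubalgebra.coe_bracket, trivial_lie_zero]; rfl
  change killingForm ℂ 𝔤 ⁅(h : 𝔤), x⁆ k = 0
  rw [← lie_skew, map_neg, LinearMap.neg_apply, LieModule.traceForm_apply_lie_apply, hk]
  simp

/-- The projection of `𝔗` onto `𝔥̂` along the root spaces. -/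
def projCartan (H : LieSubalgebra ℂ 𝔤) [H.IsCartanSubalgebra] (B : InvForm 𝔤) :
    Toroidal B →ₗ[ℂ] Cartan H :=
  (projH H ∘ₗ coeff 0 ∘ₗ Toroidal.loop).prod (Toroidal.cen.prod Toroidal.der)

lemma projCartan_incl (B : InvForm 𝔤) (h : Cartan H) : projCartan H B (Cartan.incl B h) = h := by
  ext <;> simp [projCartan, coeff_mono, projH_coe]

lemma projCartan_incl_lie (B : InvForm 𝔤) (h : Cartan H) (x : Toroidal B) :
    projCartan H B ⁅Cartan.incl B h, x⁆ = 0 := by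
  have h1 : projH H (coeff 0 (⁅Cartan.incl B h, x⁆ : Toroidal B).loop) = 0 := by
    rw [loop_incl_lie, map_add, coeff_mono_zero_lie, coeff_loopDer, map_add, projH_lie]
    simp
  exact Prod.ext h1 (Prod.ext (cen_incl_lie B h x) rfl)

lemma projCartan_nPos {B : InvForm 𝔤} {x : Toroidal B} (hx : x ∈ rtSum B (posSet b θ B)) :
    projCartan H B x = 0 := by
  refine rtSum_induction (p := fun x => projCartan H B x = 0) hx
    (fun β hβ y hy => ?_) (by simp) (fun y z hy hz => by rw [map_add, hy, hz, add_zero])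
  obtain ⟨k, hk⟩ : ∃ k, β k ≠ 0 := by
    by_contra! hc
    exact ne_zero_of_mem_posSet b θ hβ (LinearMap.ext hc)
  have h := projCartan_incl_lie B k y
  rw [hy k, map_smul] at h
  exact (smul_eq_zero.mp h).resolve_left hk

attribute [local instance 100] LieRing.ofAssociativeRing

/-- The one-dimensional `𝔟_𝓘`-module `ℂ 1_λ`: `(h + x) 1_λ = λ(h) 1_λ` for `h ∈ 𝔥̂`, `x ∈ 𝔗_𝓘`. -/
def borelRep (B : InvForm 𝔤) (lam : Module.Dual ℂ (Cartan H)) :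
    borel b θ B →ₗ⁅ℂ⁆ Module.End ℂ ℂ where
  toFun x := lam (projCartan H B x) • (1 : Module.End ℂ ℂ)
  map_add' x y := by simp [add_smul]
  map_smul' r x := by simp [mul_smul]
  map_lie' {x y} := by
    rw [LieSubalgebra.coe_bracket, projCartan_nPos b θ (lie_mem_nPos_of_mem b θ x.2 y.2)]
    simp [LieRing.of_associative_ring_bracket, smul_smul, mul_comm]

lemma borelRep_apply (B : InvForm 𝔤) (lam : Module.Dual ℂ (Cartan H)) (h : Cartan H)
    (x : Toroidal B) (hx : x ∈ nPos b θ B) (hb : Cartan.incl B h + x ∈ borel b θ B) (z : ℂ) :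
    borelRep b θ B lam ⟨Cartan.incl B h + x, hb⟩ z = lam h * z := by
  change (lam (projCartan H B (Cartan.incl B h + x)) • (1 : Module.End ℂ ℂ)) z = _
  rw [map_add, projCartan_incl, projCartan_nPos b θ hx, add_zero]
  rfl

/-- The imaginary Verma module `M̄(λ) = U(𝔗) ⊗_{U(𝔟_𝓘)} ℂ 1_λ`. -/
def Verma (B : InvForm 𝔤) (lam : Module.Dual ℂ (Cartan H)) : Type _ :=
  Induced (borel b θ B) (borelRep b θ B lam)

namespace Verma

variable (B : InvForm 𝔤) (lam : Module.Dual ℂ (Cartan H))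

instance : AddCommGroup (Verma b θ B lam) :=
  inferInstanceAs (AddCommGroup (Induced (borel b θ B) (borelRep b θ B lam)))

instance : Module (UniversalEnvelopingAlgebra ℂ (Toroidal B)) (Verma b θ B lam) :=
  inferInstanceAs (Module (UniversalEnvelopingAlgebra ℂ (Toroidal B))
    (Induced (borel b θ B) (borelRep b θ B lam)))

instance : Module ℂ (Verma b θ B lam) :=
  inferInstanceAs (Module ℂ (Induced (borel b θ B) (borelRep b θ B lam)))

instance : IsScalarTower ℂ (UniversalEnvelopingAlgebra ℂ (Toroidal B)) (Verma b θ B lam) :=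
  inferInstanceAs (IsScalarTower ℂ (UniversalEnvelopingAlgebra ℂ (Toroidal B))
    (Induced (borel b θ B) (borelRep b θ B lam)))

/-- `M̄(λ)` as a `𝔗`-module. -/
instance : LieRingModule (Toroidal B) (Verma b θ B lam) where
  bracket x v := UniversalEnvelopingAlgebra.ι ℂ x • v
  add_lie x y v := by
    change UniversalEnvelopingAlgebra.ι ℂ (x + y) • v = _
    rw [map_add, add_smul]
  lie_add x v w := smul_add _ v w
  leibniz_lie x y v := by
    change UniversalEnvelopingAlgebra.ι ℂ x • UniversalEnvelopingAlgebra.ι ℂ y • v =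
      UniversalEnvelopingAlgebra.ι ℂ ⁅x, y⁆ • v +
        UniversalEnvelopingAlgebra.ι ℂ y • UniversalEnvelopingAlgebra.ι ℂ x • v
    rw [LieHom.map_lie, LieRing.of_associative_ring_bracket, sub_smul, mul_smul, mul_smul,
      sub_add_cancel]

instance : LieModule ℂ (Toroidal B) (Verma b θ B lam) where
  smul_lie r x v := by
    change UniversalEnvelopingAlgebra.ι ℂ (r • x) • v = r • (UniversalEnvelopingAlgebra.ι ℂ x • v)
    rw [map_smul, smul_assoc]
  lie_smul r x v := by
    change UniversalEnvelopingAlgebra.ι ℂ x • (r • v) = r • (UniversalEnvelopingAlgebra.ι ℂ x • v)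
    rw [← algebraMap_smul (UniversalEnvelopingAlgebra ℂ (Toroidal B)) r v,
      ← algebraMap_smul (UniversalEnvelopingAlgebra ℂ (Toroidal B)) r, smul_smul, smul_smul,
      Algebra.commutes]

/-- `M̄(λ)` as a `U(𝔗_{-𝓘})`-module, by restriction. -/
instance : Module (UniversalEnvelopingAlgebra ℂ (nNeg b θ B)) (Verma b θ B lam) :=
  Module.compHom _ (envMap (nNeg b θ B)).toRingHom

/-- The generator `1 ⊗ 1_λ` of `M̄(λ)`. -/
def gen : Verma b θ B lam :=
  (Submodule.Quotient.mk (1 ⊗ₜ[ℂ] (1 : ℂ)) : Induced (borel b θ B) (borelRep b θ B lam))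

end Verma

/-- `v` is an imaginary highest vector of weight `λ` in the `𝔗`-module `V`. -/
structure IsImHighestVector (B : InvForm 𝔤) {V : Type*} [AddCommGroup V] [Module ℂ V]
    [LieRingModule (Toroidal B) V] [LieModule ℂ (Toroidal B) V]
    (lam : Module.Dual ℂ (Cartan H)) (v : V) : Prop where
  ne_zero : v ≠ 0
  pos_lie : ∀ x ∈ nPos b θ B, ⁅x, v⁆ = 0
  weight : v ∈ wtSpace B V lam

/-- `V = U(𝔗) v`. -/
def Generates (B : InvForm 𝔤) {V : Type*} [AddCommGroup V] [Module ℂ V]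
    [LieRingModule (Toroidal B) V] [LieModule ℂ (Toroidal B) V] (v : V) : Prop :=
  ∀ w : V, ∃ u : UniversalEnvelopingAlgebra ℂ (Toroidal B), envAct V u v = w

end Borel

end DoubleAffine

end

noncomputable section

namespace DoubleAffine

/-! ### A triangular Poincaré–Birkhoff–Witt theorem -/

open MvPolynomial

/-! The proof rests on the decomposition `𝔗 = 𝔗_{-𝓘} ⊕ 𝔟_𝓘` and a PBW theorem adapted to it. At a
weight `α + m₁δ₁ + m₂δ₂` of the loop algebra, `φ` takes the value `ht α + m₁(1 + ht θ)`, where `ht 0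
= 0`. Since `0 < |ht α| ≤ ht θ` for a root `α`, this vanishes only at multiples of `δ₂`. So each
weight is zero, in `𝓘` or in `-𝓘` (`loopWt_cases`), and weight vectors of the loop algebra form a
basis of a complement `𝔗_{-𝓘}` of `𝔟_𝓘` (`negCoord_eq_zero_iff`).

The PBW theorem concerns a Lie algebra `L` with independent vectors `z_i`, a complementary
subalgebra `K` and a character of `K`. One constructs an action of `L` on polynomials in the `z_i`:
an element acts as multiplication by its linear part, up to terms that do not raise the degree, and
`K` acts on `1` by the character (`comm_monomial`). An ordered product applied to `1` gives back its
monomial (`envRep_ordMon_one`), which yields independence. In any module, straightening expresses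
everything generated by a vector on which `K` acts by the character through ordered products
(`ordMon_envRep_smul`), which yields spanning. With `K = 𝔟_𝓘` this gives a basis of `M̄(λ)`
(`vermaMap_bijective`), with `K = 0` a basis of `U(𝔗_{-𝓘})`. The two bases correspond, whence
freeness. The leading part of the action is multiplication in a domain, so no nonzero element of
`U(𝔗_{-𝓘})` kills a nonzero vector (`envRep_ordMon_ne_zero`), whence the injectivity of
homomorphisms.

The basis consists of weight vectors, so multiplicities count monomials. On `-𝓘` the functional `φ`
is nonpositive and vanishes only at the `-nδ₂`, so a monomial of weight `-kδ₂` involves only vectors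
of weights `-nδ₂` with `1 ≤ n ≤ k`: there are finitely many (`finite_monWt`). Any other monomial has
a factor of weight `β` with `β(φ) < 0`. Trading it for factors of weights `β + (n+1)δ₂` and
`-(n+1)δ₂` gives infinitely many monomials of the same weight (`infinite_monWt`). As `λ` has
multiplicity one, proper submodules have no component along the generator, and their sum is still
proper. The universal property is that of the tensor product (`Verma.exists_lift`). -/

/-- A Lie algebra `L` with linearly independent vectors `vec i`, a complement `ker coord` of their
span which is a subalgebra, and a character `char` of that subalgebra. -/
structure PBWDatum (k L ι : Type*) [CommRing k] [LieRing L] [LieAlgebra k L] where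
  vec : ι → L
  coord : L →ₗ[k] (ι →₀ k)
  coord_vec : ∀ i, coord (vec i) = Finsupp.single i 1
  char : L →ₗ[k] k
  char_vec : ∀ i, char (vec i) = 0
  coord_lie : ∀ x y, coord x = 0 → coord y = 0 → coord ⁅x, y⁆ = 0
  char_lie : ∀ x y, coord x = 0 → coord y = 0 → char ⁅x, y⁆ = 0

namespace PBWDatum

variable {k L ι : Type*} [CommRing k] [LieRing L] [LieAlgebra k L]

lemma restrictTotalDegree_le_iff {W : Submodule k (MvPolynomial ι k)} {n : ℕ} :
    restrictTotalDegree ι k n ≤ W ↔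
      ∀ M : ι →₀ ℕ, M.degree ≤ n → monomial M 1 ∈ W := by
  rw [restrictTotalDegree, restrictSupport_eq_span, Submodule.span_le]
  constructor
  · intro h M hM
    exact h ⟨M, hM, rfl⟩
  · rintro h _ ⟨M, hM, rfl⟩
    exact h M hM

lemma monomial_mem_restrictTotalDegree {M : ι →₀ ℕ} {n : ℕ} (h : M.degree ≤ n) :
    (monomial M 1 : MvPolynomial ι k) ∈ restrictTotalDegree ι k n :=
  restrictTotalDegree_le_iff.mp le_rfl M h

lemma restrictTotalDegree_mono {m n : ℕ} (h : m ≤ n) :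
    restrictTotalDegree ι k m ≤ restrictTotalDegree ι k n := by
  intro p hp
  rw [mem_restrictTotalDegree] at hp ⊢
  exact hp.trans h

lemma mul_mem_restrictTotalDegree {m n l : ℕ} {p q : MvPolynomial ι k}
    (hp : p ∈ restrictTotalDegree ι k m) (hq : q ∈ restrictTotalDegree ι k n) (h : m + n ≤ l) :
    p * q ∈ restrictTotalDegree ι k l := by
  rw [mem_restrictTotalDegree] at hp hq ⊢
  exact (totalDegree_mul p q).trans (by omega)

variable (D : PBWDatum k L ι)

/-- The linear form in `MvPolynomial ι k` with the coordinates of `x`. -/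
def sym : L →ₗ[k] MvPolynomial ι k := Finsupp.linearCombination k X ∘ₗ D.coord

lemma sym_vec (i : ι) : D.sym (D.vec i) = X i := by simp [sym, D.coord_vec]

lemma sym_of_coord_eq_zero {x : L} (h : D.coord x = 0) : D.sym x = 0 := by simp [sym, h]

lemma sym_mem (x : L) : D.sym x ∈ restrictTotalDegree ι k 1 := by
  rw [sym, LinearMap.comp_apply, Finsupp.linearCombination_apply]
  refine Submodule.sum_mem _ fun i _ => Submodule.smul_mem _ _ ?_
  exact monomial_mem_restrictTotalDegree (by simp)

/-- An element is a combination of the vectors `vec i` and an element with zero coordinates. -/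
lemma induction_vec {p : L → Prop} (hadd : ∀ x y, p x → p y → p (x + y))
    (hsmul : ∀ (r : k) x, p x → p (r • x)) (hvec : ∀ i, p (D.vec i))
    (hker : ∀ x, D.coord x = 0 → p x) (x : L) : p x := by
  have hx : D.coord (x - Finsupp.linearCombination k D.vec (D.coord x)) = 0 := by
    have : ∀ f : ι →₀ k, D.coord (Finsupp.linearCombination k D.vec f) = f := by
      intro f
      induction f using Finsupp.induction_linear with
      | zero => simp
      | add f g hf hg => simp [hf, hg]
      | single i r => simp [D.coord_vec]
    rw [map_sub, this, sub_self]
  rw [← sub_add_cancel x (Finsupp.linearCombination k D.vec (D.coord x))]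
  refine hadd _ _ (hker _ hx) ?_
  rw [Finsupp.linearCombination_apply]
  exact Finset.sum_induction _ p hadd (hker 0 (map_zero _)) fun i _ => hsmul _ _ (hvec i)

/-- The action on polynomials with leading part multiplication by `sym` and lower order part
given by `R` on monomials. -/
def actOf (R : (ι →₀ ℕ) → L →ₗ[k] MvPolynomial ι k) :
    L →ₗ[k] Module.End k (MvPolynomial ι k) :=
  LinearMap.mul k (MvPolynomial ι k) ∘ₗ D.sym + ((basisMonomials ι k).constr k R).flip

lemma actOf_monomial (R : (ι →₀ ℕ) → L →ₗ[k] MvPolynomial ι k) (x : L) (M : ι →₀ ℕ) :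
    D.actOf R x (monomial M 1) = D.sym x * monomial M 1 + R M x := by
  have := (basisMonomials ι k).constr_basis k R M
  rw [coe_basisMonomials] at this
  simp [actOf, this]

lemma actOf_mem {R : (ι →₀ ℕ) → L →ₗ[k] MvPolynomial ι k} {n : ℕ}
    (hR : ∀ M : ι →₀ ℕ, M.degree ≤ n → ∀ x, R M x ∈ restrictTotalDegree ι k M.degree) {m : ℕ}
    (hmn : m ≤ n) (x : L) {p : MvPolynomial ι k} (hp : p ∈ restrictTotalDegree ι k m) :
    D.actOf R x p - D.sym x * p ∈ restrictTotalDegree ι k m := by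
  have : restrictTotalDegree ι k m ≤ (restrictTotalDegree ι k m).comap
      (D.actOf R x - LinearMap.mul k _ (D.sym x)) := by
    rw [restrictTotalDegree_le_iff]
    intro M hM
    simpa [actOf_monomial] using restrictTotalDegree_mono hM (hR M (hM.trans hmn) x)
  simpa using this hp

lemma actOf_mem' {R : (ι →₀ ℕ) → L →ₗ[k] MvPolynomial ι k} {n : ℕ}
    (hR : ∀ M : ι →₀ ℕ, M.degree ≤ n → ∀ x, R M x ∈ restrictTotalDegree ι k M.degree) {m : ℕ}
    (hmn : m ≤ n) (x : L) {p : MvPolynomial ι k} (hp : p ∈ restrictTotalDegree ι k m) :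
    D.actOf R x p ∈ restrictTotalDegree ι k (m + 1) := by
  have h1 := restrictTotalDegree_mono (Nat.le_succ m) (D.actOf_mem hR hmn x hp)
  have h2 := mul_mem_restrictTotalDegree (D.sym_mem x) hp (add_comm 1 m).le
  simpa using add_mem h1 h2

/-- In degrees at most `n` the operator sees only the values of `R` in those degrees; this is what
lets `R` be defined by recursion on the degree. -/
lemma actOf_congr {R R' : (ι →₀ ℕ) → L →ₗ[k] MvPolynomial ι k} {n : ℕ}
    (hR : ∀ M : ι →₀ ℕ, M.degree ≤ n → R M = R' M) (x : L) {p : MvPolynomial ι k}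
    (hp : p ∈ restrictTotalDegree ι k n) : D.actOf R x p = D.actOf R' x p := by
  have : restrictTotalDegree ι k n ≤ LinearMap.ker (D.actOf R x - D.actOf R' x) := by
    rw [restrictTotalDegree_le_iff]
    intro M hM
    simp [actOf_monomial, hR M hM]
  simpa [sub_eq_zero] using this hp

/-! ### Recursive construction of the action on polynomials -/

section Order

variable [LinearOrder ι]

/-- The components of `x` in `ker coord` and along the `vec j` with `i < j`. -/
def tail (i : ι) : L →ₗ[k] L :=
  LinearMap.id - Finsupp.linearCombination k (fun j => if j ≤ i then D.vec j else 0) ∘ₗ D.coord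

lemma tail_vec_of_le {i j : ι} (h : j ≤ i) : D.tail i (D.vec j) = 0 := by
  simp [tail, D.coord_vec, h]

lemma tail_vec_of_lt {i j : ι} (h : i < j) : D.tail i (D.vec j) = D.vec j := by
  simp [tail, D.coord_vec, h.not_ge]

lemma tail_of_coord_eq_zero (i : ι) {x : L} (h : D.coord x = 0) : D.tail i x = x := by
  simp [tail, h]

/-- One step of the recursion for the lower order part of the action. -/
def step (R : (ι →₀ ℕ) → L →ₗ[k] MvPolynomial ι k) (M : ι →₀ ℕ) : L →ₗ[k] MvPolynomial ι k :=
  -- Write `z_M = z_i z_P` with `i` smallest. The components of `x` along `vec j`, `j ≤ i`, should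
  -- only multiply, so they contribute nothing here. The tail `y` should satisfy `y z_i z_P = z_i (y
  -- z_P) + [y, z_i] z_P`. The leading part of `y z_P`, multiplied by `z_i`, is the leading part of
  -- `y z_M`, and the two terms below remain. On the empty monomial the lower order part is the
  -- character.
  if h : M.support.Nonempty then
    { toFun x :=
        D.actOf R (D.vec (M.support.min' h))
          (R (M - Finsupp.single (M.support.min' h) 1) (D.tail (M.support.min' h) x)) +
        D.actOf R ⁅D.tail (M.support.min' h) x, D.vec (M.support.min' h)⁆
          (monomial (M - Finsupp.single (M.support.min' h) 1) 1)
      map_add' x y := by simp only [map_add, add_lie, LinearMap.add_apply]; abel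
      map_smul' r x := by simp only [map_smul, smul_lie, LinearMap.smul_apply, smul_add,
        RingHom.id_apply] }
  else Algebra.linearMap k (MvPolynomial ι k) ∘ₗ D.char

lemma step_zero (R : (ι →₀ ℕ) → L →ₗ[k] MvPolynomial ι k) (x : L) :
    D.step R 0 x = C (D.char x) := by
  simp [step, MvPolynomial.algebraMap_eq]

lemma min'_support_single_add {i : ι} {P : ι →₀ ℕ} (h : ∀ j ∈ P.support, i ≤ j)
    (hn : (Finsupp.single i 1 + P).support.Nonempty) :
    (Finsupp.single i 1 + P).support.min' hn = i := by
  apply le_antisymm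
  · apply Finset.min'_le
    simp
  · apply Finset.le_min'
    intro j hj
    rw [Finsupp.mem_support_iff, Finsupp.add_apply] at hj
    by_cases hij : i = j
    · exact hij.le
    · rw [Finsupp.single_eq_of_ne' hij, zero_add] at hj
      exact h j (Finsupp.mem_support_iff.mpr hj)

lemma step_single_add (R : (ι →₀ ℕ) → L →ₗ[k] MvPolynomial ι k) {i : ι} {P : ι →₀ ℕ}
    (h : ∀ j ∈ P.support, i ≤ j) (x : L) :
    D.step R (Finsupp.single i 1 + P) x =
      D.actOf R (D.vec i) (R P (D.tail i x)) + D.actOf R ⁅D.tail i x, D.vec i⁆ (monomial P 1) := by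
  have hn : (Finsupp.single i 1 + P).support.Nonempty := ⟨i, by simp⟩
  rw [step, dif_pos hn]
  simp only [min'_support_single_add h, add_tsub_cancel_left]
  rfl

/-- Induction on multi-indices, adding a smallest index at each step. -/
@[elab_as_elim]
lemma induction_min {p : (ι →₀ ℕ) → Prop} (M : ι →₀ ℕ) (h0 : p 0)
    (h1 : ∀ i P, (∀ j ∈ P.support, i ≤ j) → p P → p (Finsupp.single i 1 + P)) : p M := by
  induction hn : M.degree generalizing M with
  | zero => rwa [(Finsupp.degree_eq_zero_iff M).mp hn]
  | succ n ih =>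
    have hM : M.support.Nonempty := by
      rw [Finsupp.support_nonempty_iff]
      rintro rfl
      simp at hn
    set i := M.support.min' hM with hi
    have hle : Finsupp.single i 1 ≤ M := by
      rw [Finsupp.single_le_iff]
      exact Nat.one_le_iff_ne_zero.mpr (Finsupp.mem_support_iff.mp (M.support.min'_mem hM))
    have hM' : M = Finsupp.single i 1 + (M - Finsupp.single i 1) := (add_tsub_cancel_of_le hle).symm
    rw [hM'] at hn ⊢
    refine h1 _ _ (fun j hj => Finset.min'_le _ _ (Finsupp.support_mono tsub_le_self hj))
      (ih _ ?_)
    rw [map_add, Finsupp.degree_single] at hn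
    omega

/-- At `z_i z_P` the recursion only applies operators to polynomials of degree at most that of `P`;
the bound `hf` ensures this for the value of `R` at `P`. So the values below degree `n` determine
the next ones below `n + 1`. -/
lemma step_congr {R R' : (ι →₀ ℕ) → L →ₗ[k] MvPolynomial ι k} {n : ℕ}
    (hR : ∀ M : ι →₀ ℕ, M.degree < n → R M = R' M)
    (hf : ∀ M : ι →₀ ℕ, M.degree < n → ∀ x, R M x ∈ restrictTotalDegree ι k M.degree)
    (M : ι →₀ ℕ) (hM : M.degree < n + 1) : D.step R M = D.step R' M := by
  ext1 x
  induction M using induction_min with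
  | h0 => simp [step_zero]
  | h1 i P hP _ =>
    rw [map_add, Finsupp.degree_single] at hM
    rw [step_single_add _ _ hP, step_single_add _ _ hP, ← hR P (by omega)]
    have h' : ∀ N : ι →₀ ℕ, N.degree ≤ P.degree → R N = R' N := fun N hN => hR N (by omega)
    rw [D.actOf_congr h' _ (hf P (by omega) _),
      D.actOf_congr h' _ (monomial_mem_restrictTotalDegree le_rfl)]

lemma step_mem {R : (ι →₀ ℕ) → L →ₗ[k] MvPolynomial ι k} {n : ℕ}
    (hf : ∀ M : ι →₀ ℕ, M.degree < n → ∀ x, R M x ∈ restrictTotalDegree ι k M.degree)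
    (M : ι →₀ ℕ) (hM : M.degree < n + 1) (x : L) :
    D.step R M x ∈ restrictTotalDegree ι k M.degree := by
  induction M using induction_min with
  | h0 => simp [step_zero, mem_restrictTotalDegree]
  | h1 i P hP _ =>
    rw [map_add, Finsupp.degree_single] at hM ⊢
    rw [step_single_add _ _ hP, add_comm 1]
    have h' : ∀ N : ι →₀ ℕ, N.degree ≤ P.degree → ∀ x,
        R N x ∈ restrictTotalDegree ι k N.degree := fun N hN => hf N (by omega)
    exact add_mem (D.actOf_mem' h' le_rfl _ (hf P (by omega) _))
      (D.actOf_mem' h' le_rfl _ (monomial_mem_restrictTotalDegree le_rfl))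

/-- Each iteration settles one more degree, whatever the starting point; hence the iterates from `0`
are eventually constant at every monomial. -/
lemma iterate_step (n : ℕ) (M : ι →₀ ℕ) (hM : M.degree < n) :
    D.step^[n + 1] 0 M = D.step^[n] 0 M ∧
      ∀ x, D.step^[n] 0 M x ∈ restrictTotalDegree ι k M.degree := by
  induction n generalizing M with
  | zero => omega
  | succ n ih =>
    refine ⟨?_, fun x => ?_⟩
    · rw [Function.iterate_succ_apply' D.step (n + 1)]
      nth_rw 2 [Function.iterate_succ_apply' D.step n]
      exact (D.step_congr (fun M hM => (ih M hM).1.symm) (fun M hM => (ih M hM).2) M hM).symm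
    · rw [Function.iterate_succ_apply' D.step n]
      exact D.step_mem (fun M hM => (ih M hM).2) M hM x

/-- The lower order part of the action on monomials. -/
def lower (M : ι →₀ ℕ) : L →ₗ[k] MvPolynomial ι k := D.step^[M.degree + 1] 0 M

lemma lower_eq (n : ℕ) (M : ι →₀ ℕ) (hM : M.degree < n) : D.lower M = D.step^[n] 0 M := by
  induction n with
  | zero => omega
  | succ n ih =>
    rcases (Nat.lt_succ_iff.mp hM).eq_or_lt with rfl | h
    · rfl
    · rw [ih h, (D.iterate_step n M h).1]

lemma lower_mem (M : ι →₀ ℕ) (x : L) : D.lower M x ∈ restrictTotalDegree ι k M.degree :=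
  (D.iterate_step _ M (Nat.lt_succ_self _)).2 x

lemma step_lower (M : ι →₀ ℕ) : D.step D.lower M = D.lower M := by
  rw [lower, Function.iterate_succ_apply']
  exact D.step_congr (n := M.degree) (fun N hN => D.lower_eq _ N hN) (fun N _ => D.lower_mem N) M
    (Nat.lt_succ_self _)

/-- The action of `L` on `MvPolynomial ι k`. -/
def act : L →ₗ[k] Module.End k (MvPolynomial ι k) := D.actOf D.lower

lemma act_sub_mem (x : L) {p : MvPolynomial ι k} {n : ℕ} (hp : p ∈ restrictTotalDegree ι k n) :
    D.act x p - D.sym x * p ∈ restrictTotalDegree ι k n :=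
  D.actOf_mem (fun M _ => D.lower_mem M) le_rfl x hp

lemma act_one_of_coord_eq_zero {x : L} (h : D.coord x = 0) : D.act x 1 = C (D.char x) := by
  change D.actOf D.lower x (monomial 0 1) = _
  rw [actOf_monomial, ← step_lower, step_zero, D.sym_of_coord_eq_zero h]
  simp

/-- If `j` is the smallest index of `P` and `i ≤ j`, the tail of `vec i` at `j` is zero, so the
recursion gives no lower order term. -/
lemma act_vec_monomial {i : ι} {P : ι →₀ ℕ} (h : ∀ j ∈ P.support, i ≤ j) :
    D.act (D.vec i) (monomial P 1) = monomial (Finsupp.single i 1 + P) 1 := by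
  rw [act, actOf_monomial, D.sym_vec]
  have : D.lower P (D.vec i) = 0 := by
    induction P using induction_min with
    | h0 => rw [← step_lower, step_zero, D.char_vec, C_0]
    | h1 j P hP _ =>
      rw [← step_lower, D.step_single_add _ hP, D.tail_vec_of_le (h j (by simp))]
      simp
  rw [this, add_zero, X, monomial_mul, one_mul]

lemma act_vec_sym_tail {i : ι} {P : ι →₀ ℕ} (h : ∀ j ∈ P.support, i ≤ j) (x : L) :
    D.act (D.vec i) (D.sym (D.tail i x) * monomial P 1) =
      X i * (D.sym (D.tail i x) * monomial P 1) := by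
  induction x using D.induction_vec with
  | hadd x y hx hy => simp only [map_add, add_mul, mul_add, hx, hy]
  | hsmul r x hx => simp only [map_smul, Algebra.smul_mul_assoc, Algebra.mul_smul_comm, hx]
  | hvec j =>
    rcases le_or_gt j i with hj | hj
    · simp [D.tail_vec_of_le hj]
    · rw [D.tail_vec_of_lt hj, D.sym_vec, X, X, monomial_mul, monomial_mul, one_mul, one_mul]
      refine D.act_vec_monomial fun l hl => ?_
      rw [Finsupp.mem_support_iff, Finsupp.add_apply] at hl
      by_cases hjl : j = l
      · exact hjl ▸ hj.le
      · rw [Finsupp.single_eq_of_ne' hjl, zero_add] at hl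
        exact h l (Finsupp.mem_support_iff.mpr hl)
  | hker x hx => simp [D.tail_of_coord_eq_zero i hx, D.sym_of_coord_eq_zero hx]

/-- This is the recursion read as a commutation relation: `vec i` multiplies the leading part of `x
z_P` exactly, because only indices above `i` occur in the linear part of a tail. -/
lemma act_tail_monomial {i : ι} {P : ι →₀ ℕ} (h : ∀ j ∈ P.support, i ≤ j) {x : L}
    (hx : D.tail i x = x) :
    D.act x (monomial (Finsupp.single i 1 + P) 1) =
      D.act (D.vec i) (D.act x (monomial P 1)) + D.act ⁅x, D.vec i⁆ (monomial P 1) := by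
  have h1 := D.act_vec_sym_tail h x
  rw [hx] at h1
  have h2 : D.act x (monomial P 1) = D.sym x * monomial P 1 + D.lower P x := D.actOf_monomial _ _ _
  rw [h2, map_add, h1]
  rw [act, actOf_monomial, ← step_lower, step_single_add _ _ h, hx]
  have h3 : (monomial (Finsupp.single i 1 + P) 1 : MvPolynomial ι k) = X i * monomial P 1 := by
    rw [X, monomial_mul, one_mul]
  rw [h3]
  ring

/-! ### The commutation relations -/

/-- The commutation relation of `x`, `y` at the polynomial `p`. -/
def Comm (x y : L) (p : MvPolynomial ι k) : Prop :=
  D.act x (D.act y p) - D.act y (D.act x p) = D.act ⁅x, y⁆ p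

variable {D}

lemma Comm.symm {x y : L} {p : MvPolynomial ι k} (h : D.Comm x y p) : D.Comm y x p := by
  rw [Comm] at h ⊢
  rw [← lie_skew, map_neg, LinearMap.neg_apply, ← h, neg_sub]

lemma Comm.add_left {x x' y : L} {p : MvPolynomial ι k} (h : D.Comm x y p) (h' : D.Comm x' y p) :
    D.Comm (x + x') y p := by
  rw [Comm] at h h' ⊢
  simp only [map_add, LinearMap.add_apply, add_lie, ← h, ← h']
  abel

lemma Comm.smul_left {x y : L} {p : MvPolynomial ι k} (r : k) (h : D.Comm x y p) :
    D.Comm (r • x) y p := by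
  rw [Comm] at h ⊢
  simp only [map_smul, LinearMap.smul_apply, smul_lie, ← h, smul_sub]

lemma Comm.add_right {x y : L} {p q : MvPolynomial ι k} (h : D.Comm x y p) (h' : D.Comm x y q) :
    D.Comm x y (p + q) := by
  rw [Comm] at h h' ⊢
  simp only [map_add, ← h, ← h']
  abel

lemma Comm.smul_right {x y : L} {p : MvPolynomial ι k} (r : k) (h : D.Comm x y p) :
    D.Comm x y (r • p) := by
  rw [Comm] at h ⊢
  simp only [map_smul, ← h, smul_sub]

lemma Comm.of_monomial {x y : L} {n : ℕ}
    (h : ∀ M : ι →₀ ℕ, M.degree ≤ n → D.Comm x y (monomial M 1)) {p : MvPolynomial ι k}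
    (hp : p ∈ restrictTotalDegree ι k n) : D.Comm x y p := by
  let W : Submodule k (MvPolynomial ι k) :=
    { carrier := {p | D.Comm x y p}
      add_mem' := Comm.add_right
      zero_mem' := by simp [Comm]
      smul_mem' := fun r _ h => Comm.smul_right r h }
  exact (restrictTotalDegree_le_iff (W := W)).mpr h hp

variable (D)

/-- For `x` equal to its tail at `i` this is the recursion. For `x = vec j` with `j < i` the roles
are exchanged, since `j` is then also a lower bound for the indices of `P`. -/
lemma comm_vec {i : ι} {P : ι →₀ ℕ} (h : ∀ j ∈ P.support, i ≤ j) (x : L) :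
    D.Comm x (D.vec i) (monomial P 1) := by
  have key : ∀ {i : ι} {x : L}, (∀ j ∈ P.support, i ≤ j) → D.tail i x = x →
      D.Comm x (D.vec i) (monomial P 1) := by
    intro i x h hx
    rw [Comm, D.act_vec_monomial h, D.act_tail_monomial h hx, add_sub_cancel_left]
  induction x using D.induction_vec with
  | hadd x y hx hy => exact hx.add_left hy
  | hsmul r x hx => exact hx.smul_left r
  | hvec j =>
    rcases lt_trichotomy i j with hj | rfl | hj
    · exact key h (D.tail_vec_of_lt hj)
    · simp [Comm]
    · exact (key (fun l hl => hj.le.trans (h l hl)) (D.tail_vec_of_lt hj)).symm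
  | hker x hx => exact key h (D.tail_of_coord_eq_zero i hx)

/-- The polynomial `y z_P` is `sym y * z_P` plus terms of degree at most that of `P`. The latter
fall under the induction hypothesis, and the former is a combination of monomials with all indices
at least `i`, to which `comm_vec` applies. -/
lemma comm_vec_act {i : ι} {P : ι →₀ ℕ} (h : ∀ j ∈ P.support, i ≤ j)
    (ih : ∀ M : ι →₀ ℕ, M.degree ≤ P.degree → ∀ x y, D.Comm x y (monomial M 1))
    {x y : L} (hy : D.tail i y = y) : D.Comm x (D.vec i) (D.act y (monomial P 1)) := by
  rw [← sub_add_cancel (D.act y (monomial P 1)) (D.sym y * monomial P 1)]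
  refine Comm.add_right (Comm.of_monomial (fun M hM => ih M hM _ _)
    (D.act_sub_mem y (monomial_mem_restrictTotalDegree le_rfl))) ?_
  rw [← hy]
  clear hy
  induction y using D.induction_vec with
  | hadd y y' hy hy' =>
    rw [map_add, map_add, add_mul]
    exact hy.add_right hy'
  | hsmul r y hy =>
    rw [map_smul, map_smul, smul_mul_assoc]
    exact hy.smul_right r
  | hvec j =>
    rcases le_or_gt j i with hj | hj
    · simp [D.tail_vec_of_le hj, Comm]
    · rw [D.tail_vec_of_lt hj, D.sym_vec, X, monomial_mul, one_mul]
      refine D.comm_vec (fun l hl => ?_) x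
      rw [Finsupp.mem_support_iff, Finsupp.add_apply] at hl
      by_cases hjl : j = l
      · exact hjl ▸ hj.le
      · rw [Finsupp.single_eq_of_ne' hjl, zero_add] at hl
        exact h l (Finsupp.mem_support_iff.mpr hl)
  | hker y hy => simp [D.tail_of_coord_eq_zero i hy, D.sym_of_coord_eq_zero hy, Comm]

/-- Induction on the degree. On `1`, two elements of the subalgebra act by commuting scalars, and
the character kills their bracket. On `z_i z_P` with `i` smallest, `comm_vec` covers the case where
one of the elements is `vec j` with `j ≤ i`; only pairs of tails need an argument. -/
lemma comm_monomial (M : ι →₀ ℕ) (x y : L) : D.Comm x y (monomial M 1) := by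
  induction hn : M.degree using Nat.strong_induction_on generalizing M x y with
  | _ n ih =>
  induction M using induction_min with
  | h0 =>
    have hv : ∀ i x, D.Comm x (D.vec i) (monomial 0 1) := fun i x => D.comm_vec (by simp) x
    induction x using D.induction_vec with
    | hadd x x' hx hx' => exact hx.add_left hx'
    | hsmul r x hx => exact hx.smul_left r
    | hvec i => exact (hv i y).symm
    | hker x hx =>
      refine Comm.symm ?_
      induction y using D.induction_vec with
      | hadd x x' hx hx' => exact hx.add_left hx'
      | hsmul r x hx => exact hx.smul_left r
      | hvec i => exact (hv i x).symm
      | hker y hy =>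
        rw [Comm]
        change D.act y (D.act x 1) - D.act x (D.act y 1) = D.act ⁅y, x⁆ 1
        rw [D.act_one_of_coord_eq_zero hx, D.act_one_of_coord_eq_zero hy,
          D.act_one_of_coord_eq_zero (D.coord_lie y x hy hx), D.char_lie y x hy hx]
        have hC : ∀ r : k, (C r : MvPolynomial ι k) = r • 1 := fun r => by
          rw [smul_eq_C_mul, mul_one]
        rw [hC, hC, map_smul, map_smul, D.act_one_of_coord_eq_zero hx,
          D.act_one_of_coord_eq_zero hy, hC, hC, smul_smul, smul_smul, mul_comm]
        simp
  | h1 i P hP hi =>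
    clear hi
    rw [map_add, Finsupp.degree_single] at hn
    have ih' : ∀ M : ι →₀ ℕ, M.degree ≤ P.degree → ∀ x y, D.Comm x y (monomial M 1) :=
      fun M hM x y => ih M.degree (by omega) M x y rfl
    have hvec : ∀ j, j ≤ i → ∀ x, D.Comm x (D.vec j) (monomial (Finsupp.single i 1 + P) 1) := by
      intro j hj x
      refine D.comm_vec (fun l hl => ?_) x
      rw [Finsupp.mem_support_iff, Finsupp.add_apply] at hl
      by_cases hil : i = l
      · exact hil ▸ hj
      · rw [Finsupp.single_eq_of_ne' hil, zero_add] at hl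
        exact hj.trans (hP l (Finsupp.mem_support_iff.mpr hl))
    have key : ∀ x y, D.tail i x = x → D.tail i y = y →
        D.Comm x y (monomial (Finsupp.single i 1 + P) 1) := by
      intro x y hx hy
      -- Replace `z_M` by `v z_P` and move `x` and `y` past `v`. The relations needed at `z_P` hold
      -- by induction, those at `x z_P` and `y z_P` by `comm_vec_act`, and the Jacobi identity for
      -- `[[x, y], v]` makes them add up.
      rw [← D.act_vec_monomial hP]
      set v := D.vec i
      set p : MvPolynomial ι k := monomial P 1
      have hip := ih' P le_rfl
      have e1 : D.act x (D.act v (D.act y p)) - D.act v (D.act x (D.act y p)) =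
          D.act ⁅x, v⁆ (D.act y p) := D.comm_vec_act hP ih' hy
      have e2 : D.act y (D.act v (D.act x p)) - D.act v (D.act y (D.act x p)) =
          D.act ⁅y, v⁆ (D.act x p) := D.comm_vec_act hP ih' hx
      have e3 : D.act y (D.act v p) - D.act v (D.act y p) = D.act ⁅y, v⁆ p := hip y v
      have e4 : D.act x (D.act v p) - D.act v (D.act x p) = D.act ⁅x, v⁆ p := hip x v
      have e5 : D.act x (D.act ⁅y, v⁆ p) - D.act ⁅y, v⁆ (D.act x p) = D.act ⁅x, ⁅y, v⁆⁆ p :=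
        hip x ⁅y, v⁆
      have e6 : D.act y (D.act ⁅x, v⁆ p) - D.act ⁅x, v⁆ (D.act y p) = D.act ⁅y, ⁅x, v⁆⁆ p :=
        hip y ⁅x, v⁆
      have e7 : D.act x (D.act y p) - D.act y (D.act x p) = D.act ⁅x, y⁆ p := hip x y
      have e8 : D.act ⁅x, y⁆ (D.act v p) - D.act v (D.act ⁅x, y⁆ p) = D.act ⁅⁅x, y⁆, v⁆ p :=
        hip ⁅x, y⁆ v
      rw [sub_eq_iff_eq_add] at e3 e4
      rw [lie_lie, map_sub, LinearMap.sub_apply, ← e5, ← e6, ← e7, map_sub] at e8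
      rw [Comm, e3, e4, map_add, map_add]
      linear_combination (exp := 1) e1 - e2 - e8
    induction x using D.induction_vec with
    | hadd x x' hx hx' => exact hx.add_left hx'
    | hsmul r x hx => exact hx.smul_left r
    | hvec j =>
      rcases le_or_gt j i with hj | hj
      · exact (hvec j hj y).symm
      · refine Comm.symm ?_
        induction y using D.induction_vec with
        | hadd x x' hx hx' => exact hx.add_left hx'
        | hsmul r x hx => exact hx.smul_left r
        | hvec l =>
          rcases le_or_gt l i with hl | hl
          · exact (hvec l hl _).symm
          · exact key _ _ (D.tail_vec_of_lt hl) (D.tail_vec_of_lt hj)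
        | hker y hy => exact key _ _ (D.tail_of_coord_eq_zero i hy) (D.tail_vec_of_lt hj)
    | hker x hx =>
      refine Comm.symm ?_
      induction y using D.induction_vec with
      | hadd x x' hx hx' => exact hx.add_left hx'
      | hsmul r x hx => exact hx.smul_left r
      | hvec l =>
        rcases le_or_gt l i with hl | hl
        · exact (hvec l hl _).symm
        · exact key _ _ (D.tail_vec_of_lt hl) (D.tail_of_coord_eq_zero i hx)
      | hker y hy => exact key _ _ (D.tail_of_coord_eq_zero i hy) (D.tail_of_coord_eq_zero i hx)

attribute [local instance 100] LieRing.ofAssociativeRing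

/-- The representation of `L` on `MvPolynomial ι k`. -/
def rep : L →ₗ⁅k⁆ Module.End k (MvPolynomial ι k) where
  __ := D.act
  map_lie' {x y} := by
    have h : D.act ⁅x, y⁆ = D.act x * D.act y - D.act y * D.act x := by
      refine (basisMonomials ι k).ext fun M => ?_
      rw [coe_basisMonomials]
      exact Eq.symm (D.comm_monomial M x y)
    exact h

end Order

end PBWDatum

end DoubleAffine

/-! ### Ordered monomials in the enveloping algebra -/

namespace DoubleAffine

open MvPolynomial

attribute [local instance 100] LieRing.ofAssociativeRing

/-- The elements with property `p` form a subalgebra containing the image of `ι`. By the universal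
property, `U(L)` maps to it, and the composite with the inclusion is the identity. -/
lemma env_induction {k L : Type*} [CommRing k] [LieRing L] [LieAlgebra k L]
    {p : UniversalEnvelopingAlgebra k L → Prop} (u : UniversalEnvelopingAlgebra k L)
    (halg : ∀ r, p (algebraMap k _ r)) (hι : ∀ x, p (UniversalEnvelopingAlgebra.ι k x))
    (hmul : ∀ a b, p a → p b → p (a * b)) (hadd : ∀ a b, p a → p b → p (a + b)) : p u := by
  let s : Subalgebra k (UniversalEnvelopingAlgebra k L) :=
    { carrier := {u | p u}
      mul_mem' := fun {a b} => hmul a b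
      add_mem' := fun {a b} => hadd a b
      algebraMap_mem' := halg }
  let f : L →ₗ⁅k⁆ s :=
    { toFun := fun x => ⟨UniversalEnvelopingAlgebra.ι k x, hι x⟩
      map_add' := fun x y => Subtype.ext (map_add _ x y)
      map_smul' := fun r x => Subtype.ext (map_smul _ r x)
      map_lie' := fun {x y} => Subtype.ext (LieHom.map_lie _ x y) }
  have h : s.val.comp (UniversalEnvelopingAlgebra.lift k f) = AlgHom.id k _ := by
    ext x
    change ((UniversalEnvelopingAlgebra.lift k f (UniversalEnvelopingAlgebra.ι k x) : s) :
      UniversalEnvelopingAlgebra k L) = UniversalEnvelopingAlgebra.ι k x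
    rw [UniversalEnvelopingAlgebra.lift_ι_apply]
    rfl
  have h' := DFunLike.congr_fun h u
  rw [AlgHom.id_apply] at h'
  rw [← h']
  exact (UniversalEnvelopingAlgebra.lift k f u).2

namespace PBWDatum

variable {k L ι : Type*} [CommRing k] [LieRing L] [LieAlgebra k L] [LinearOrder ι]
variable (D : PBWDatum k L ι)

/-- The product in increasing order of the vectors `vec i` with multiplicities `M i`. -/
def ordProd (M : ι →₀ ℕ) : UniversalEnvelopingAlgebra k L :=
  ((M.toMultiset.sort (· ≤ ·)).map fun i => UniversalEnvelopingAlgebra.ι k (D.vec i)).prod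

lemma ordProd_zero : D.ordProd 0 = 1 := by simp [ordProd]

lemma ordProd_single_add {i : ι} {P : ι →₀ ℕ} (h : ∀ j ∈ P.support, i ≤ j) :
    D.ordProd (Finsupp.single i 1 + P) =
      UniversalEnvelopingAlgebra.ι k (D.vec i) * D.ordProd P := by
  rw [ordProd, map_add, Finsupp.toMultiset_single, one_smul, Multiset.singleton_add,
    Multiset.sort_cons, List.map_cons, List.prod_cons, ordProd]
  intro j hj
  exact h j (by rwa [Finsupp.mem_toMultiset] at hj)

/-- The linear map sending a monomial to the ordered product of the `vec i`. -/
def ordMon : MvPolynomial ι k →ₗ[k] UniversalEnvelopingAlgebra k L :=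
  (basisMonomials ι k).constr k D.ordProd

lemma ordMon_monomial (M : ι →₀ ℕ) : D.ordMon (monomial M 1) = D.ordProd M := by
  have := (basisMonomials ι k).constr_basis k D.ordProd M
  rwa [coe_basisMonomials] at this

lemma ordMon_one : D.ordMon 1 = 1 := by
  rw [← D.ordProd_zero, ← D.ordMon_monomial]
  rfl

/-- The action of `U(L)` on `MvPolynomial ι k`. -/
def envRep : UniversalEnvelopingAlgebra k L →ₐ[k] Module.End k (MvPolynomial ι k) :=
  UniversalEnvelopingAlgebra.lift k D.rep

lemma envRep_ι (x : L) : D.envRep (UniversalEnvelopingAlgebra.ι k x) = D.act x :=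
  UniversalEnvelopingAlgebra.lift_ι_apply k D.rep x

/-- The factors act from the largest index down to the smallest, so each one merely multiplies by
its variable. -/
lemma envRep_ordProd_one (M : ι →₀ ℕ) : D.envRep (D.ordProd M) 1 = monomial M 1 := by
  induction M using induction_min with
  | h0 => rw [ordProd_zero, map_one D.envRep]; rfl
  | h1 i P hP ih =>
    rw [D.ordProd_single_add hP, map_mul, Module.End.mul_apply, ih, envRep_ι,
      D.act_vec_monomial hP]

lemma envRep_ordMon_one (p : MvPolynomial ι k) : D.envRep (D.ordMon p) 1 = p := by
  have : ((LinearMap.applyₗ (1 : MvPolynomial ι k)) ∘ₗ D.envRep.toLinearMap) ∘ₗ D.ordMon =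
      LinearMap.id := by
    refine (basisMonomials ι k).ext fun M => ?_
    rw [coe_basisMonomials]
    change D.envRep (D.ordMon (monomial M 1)) 1 = monomial M 1
    rw [ordMon_monomial, envRep_ordProd_one]
  exact LinearMap.congr_fun this p

section Module

variable {V : Type*} [AddCommGroup V] [Module k V] [Module (UniversalEnvelopingAlgebra k L) V]
  [IsScalarTower k (UniversalEnvelopingAlgebra k L) V] {v : V}

/-- Straightening: the recursion for the action uses only relations that hold in `U(L)` and at `v`,
so it remains valid for ordered products applied to `v`. The induction parallels `comm_monomial`. -/
lemma ordMon_act_smul (hv : ∀ y, D.coord y = 0 →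
    UniversalEnvelopingAlgebra.ι k y • v = D.char y • v) (x : L) (p : MvPolynomial ι k) :
    D.ordMon (D.act x p) • v = UniversalEnvelopingAlgebra.ι k x • D.ordMon p • v := by
  have hmem : ∀ (n : ℕ) (x : L), (∀ M : ι →₀ ℕ, M.degree ≤ n →
      D.ordMon (D.act x (monomial M 1)) • v =
        UniversalEnvelopingAlgebra.ι k x • D.ordMon (monomial M 1) • v) →
      ∀ p ∈ restrictTotalDegree ι k n, D.ordMon (D.act x p) • v =
        UniversalEnvelopingAlgebra.ι k x • D.ordMon p • v := by
    intro n x h p hp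
    let W : Submodule k (MvPolynomial ι k) :=
      { carrier := {p | D.ordMon (D.act x p) • v =
          UniversalEnvelopingAlgebra.ι k x • D.ordMon p • v}
        add_mem' := fun {p q} hp hq => by
          simp only [Set.mem_ofPred_eq] at hp hq ⊢
          rw [map_add, map_add, add_smul, hp, hq, map_add, add_smul, smul_add]
        zero_mem' := by simp
        smul_mem' := fun r p hp => by
          simp only [Set.mem_ofPred_eq] at hp ⊢
          rw [map_smul, map_smul, map_smul, smul_assoc, hp, smul_assoc,
            smul_algebra_smul_comm] }
    exact (restrictTotalDegree_le_iff (W := W)).mpr h hp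
  have hvec : ∀ {i : ι} {P : ι →₀ ℕ}, (∀ j ∈ P.support, i ≤ j) →
      D.ordMon (D.act (D.vec i) (monomial P 1)) • v =
        UniversalEnvelopingAlgebra.ι k (D.vec i) • D.ordMon (monomial P 1) • v := by
    intro i P h
    rw [D.act_vec_monomial h, ordMon_monomial, ordMon_monomial, D.ordProd_single_add h, mul_smul]
  refine hmem p.totalDegree x (fun M hM => ?_) p (by rw [mem_restrictTotalDegree])
  clear hM p
  induction hn : M.degree using Nat.strong_induction_on generalizing M x with
  | _ n ih =>
  induction M using induction_min with
  | h0 =>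
    induction x using D.induction_vec with
    | hadd x y hx hy => simp only [map_add, LinearMap.add_apply, add_smul, hx, hy]
    | hsmul r x hx => simp only [map_smul, LinearMap.smul_apply, smul_assoc, hx]
    | hvec i => exact hvec (by simp)
    | hker x hx =>
      change D.ordMon (D.act x 1) • v = UniversalEnvelopingAlgebra.ι k x • D.ordMon 1 • v
      have hC : (C (D.char x) : MvPolynomial ι k) = D.char x • 1 := by
        rw [smul_eq_C_mul, mul_one]
      rw [D.act_one_of_coord_eq_zero hx, hC, map_smul, smul_assoc, ordMon_one, one_smul, hv x hx]
  | h1 i P hP hi =>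
    clear hi
    rw [map_add, Finsupp.degree_single] at hn
    have ih' := fun x => hmem P.degree x fun M hM => ih M.degree (by omega) x M rfl
    have key : ∀ x, D.tail i x = x → D.ordMon (D.act x (monomial (Finsupp.single i 1 + P) 1)) • v =
        UniversalEnvelopingAlgebra.ι k x •
          D.ordMon (monomial (Finsupp.single i 1 + P) 1) • v := by
      intro x hx
      have hP' := monomial_mem_restrictTotalDegree (k := k) (le_refl P.degree)
      have e1 : D.ordMon (D.act (D.vec i) (D.sym x * monomial P 1)) • v =
          UniversalEnvelopingAlgebra.ι k (D.vec i) • D.ordMon (D.sym x * monomial P 1) • v := by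
        rw [← hx]
        clear hx
        induction x using D.induction_vec with
        | hadd y y' hy hy' => simp only [map_add, add_mul, add_smul, smul_add, hy, hy']
        | hsmul r y hy =>
          simp only [map_smul, smul_mul_assoc, smul_assoc, hy, smul_algebra_smul_comm]
        | hvec j =>
          rcases le_or_gt j i with hj | hj
          · simp [D.tail_vec_of_le hj]
          · rw [D.tail_vec_of_lt hj, D.sym_vec, X, monomial_mul, one_mul]
            refine hvec fun l hl => ?_
            rw [Finsupp.mem_support_iff, Finsupp.add_apply] at hl
            by_cases hjl : j = l
            · exact hjl ▸ hj.le
            · rw [Finsupp.single_eq_of_ne' hjl, zero_add] at hl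
              exact hP l (Finsupp.mem_support_iff.mpr hl)
        | hker y hy => simp [D.tail_of_coord_eq_zero i hy, D.sym_of_coord_eq_zero hy]
      -- The polynomial `x z_P` is again split: `e1` treats its leading part, and the induction
      -- hypothesis treats the rest, which has degree at most that of `P`.
      have e2 := ih' (D.vec i) _ (D.act_sub_mem x hP')
      have e3 : D.ordMon (D.act (D.vec i) (D.act x (monomial P 1))) • v =
          UniversalEnvelopingAlgebra.ι k (D.vec i) • D.ordMon (D.act x (monomial P 1)) • v := by
        rw [map_sub, map_sub, map_sub, sub_smul, sub_smul, smul_sub, e1] at e2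
        exact sub_left_injective e2
      rw [D.act_tail_monomial hP hx, map_add, add_smul, e3, ih' x _ hP', ih' _ _ hP',
        LieHom.map_lie, LieRing.of_associative_ring_bracket, sub_smul, mul_smul, mul_smul,
        add_sub_cancel, ← D.act_vec_monomial hP, hvec hP]
    induction x using D.induction_vec with
    | hadd x y hx hy => simp only [map_add, LinearMap.add_apply, add_smul, hx, hy]
    | hsmul r x hx => simp only [map_smul, LinearMap.smul_apply, smul_assoc, hx]
    | hvec j =>
      rcases le_or_gt j i with hj | hj
      · refine hvec fun l hl => ?_
        rw [Finsupp.mem_support_iff, Finsupp.add_apply] at hl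
        by_cases hil : i = l
        · exact hil ▸ hj
        · rw [Finsupp.single_eq_of_ne' hil, zero_add] at hl
          exact hj.trans (hP l (Finsupp.mem_support_iff.mpr hl))
      · exact key _ (D.tail_vec_of_lt hj)
    | hker x hx => exact key _ (D.tail_of_coord_eq_zero i hx)

lemma ordMon_envRep_smul (hv : ∀ y, D.coord y = 0 →
    UniversalEnvelopingAlgebra.ι k y • v = D.char y • v) (u : UniversalEnvelopingAlgebra k L)
    (p : MvPolynomial ι k) :
    D.ordMon (D.envRep u p) • v = u • D.ordMon p • v := by
  induction u using env_induction generalizing p with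
  | halg r =>
    rw [AlgHom.commutes, Module.algebraMap_end_apply, map_smul, smul_assoc, algebraMap_smul]
  | hι x => rw [envRep_ι, D.ordMon_act_smul hv]
  | hmul a b ha hb => rw [map_mul, Module.End.mul_apply, ha, hb, mul_smul]
  | hadd a b ha hb => rw [map_add, LinearMap.add_apply, map_add, add_smul, ha, hb, add_smul]

end Module

/-- If `ker coord = 0`, the ordered monomials are a basis of `U(L)`. -/
lemma ordMon_envRep_one (h : ∀ x, D.coord x = 0 → x = 0) (u : UniversalEnvelopingAlgebra k L) :
    D.ordMon (D.envRep u 1) = u := by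
  -- Straightening is applied to the left regular module and the vector `1`; the condition on the
  -- kernel is void.
  have := D.ordMon_envRep_smul (v := (1 : UniversalEnvelopingAlgebra k L))
    (fun y hy => by simp [h y hy]) u 1
  simpa [ordMon_one] using this

/-- Each factor multiplies by its variable up to terms of no higher degree, so the error stays one
degree below the product. The subtraction is truncated: if both degrees are `0`, the bound is `0`
and carries no drop. -/
lemma envRep_ordProd_sub_mem (M : ι →₀ ℕ) {r : MvPolynomial ι k} {e : ℕ}
    (hr : r ∈ restrictTotalDegree ι k e) :
    D.envRep (D.ordProd M) r - monomial M 1 * r ∈ restrictTotalDegree ι k (M.degree + e - 1) := by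
  induction M using induction_min with
  | h0 =>
    rw [ordProd_zero, map_one D.envRep, Module.End.one_apply]
    change r - 1 * r ∈ _
    rw [one_mul, sub_self]
    exact Submodule.zero_mem _
  | h1 i P hP ih =>
    have hd : (Finsupp.single i 1 + P).degree + e - 1 = P.degree + e := by
      rw [map_add, Finsupp.degree_single]; omega
    have hX : (monomial (Finsupp.single i 1 + P) 1 : MvPolynomial ι k) = X i * monomial P 1 := by
      rw [X, monomial_mul, one_mul]
    rw [hd, D.ordProd_single_add hP, map_mul, Module.End.mul_apply, envRep_ι, hX]
    have h1 := D.act_sub_mem (D.vec i) (mul_mem_restrictTotalDegree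
      (monomial_mem_restrictTotalDegree (k := k) (le_refl P.degree)) hr le_rfl)
    rw [sym_vec] at h1
    have h2 : D.act (D.vec i) (D.envRep (D.ordProd P) r - monomial P 1 * r) ∈
        restrictTotalDegree ι k (P.degree + e) := by
      -- For `P = 0` and `e = 0` truncation would spoil the degree count, but then the error is
      -- exactly zero.
      rcases eq_or_ne P 0 with rfl | hP0
      · rw [ordProd_zero, map_one D.envRep, Module.End.one_apply]
        change D.act (D.vec i) (r - 1 * r) ∈ restrictTotalDegree ι k (0 + e)
        rw [one_mul, sub_self, map_zero]
        exact Submodule.zero_mem _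
      · have hpos : P.degree ≠ 0 := fun h => hP0 ((Finsupp.degree_eq_zero_iff P).mp h)
        have h3 := restrictTotalDegree_mono (show P.degree + e - 1 ≤ P.degree + e by omega)
          (D.act_sub_mem (D.vec i) ih)
        have h4 := mul_mem_restrictTotalDegree (D.sym_mem (D.vec i)) ih
          (show 1 + (P.degree + e - 1) ≤ P.degree + e by omega)
        simpa using add_mem h3 h4
    have h5 := add_mem h1 h2
    rw [map_sub] at h5
    convert h5 using 1
    ring

lemma envRep_ordMon_sub_mem {p r : MvPolynomial ι k} {d e : ℕ}
    (hp : p ∈ restrictTotalDegree ι k d) (hr : r ∈ restrictTotalDegree ι k e) :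
    D.envRep (D.ordMon p) r - p * r ∈ restrictTotalDegree ι k (d + e - 1) := by
  have : restrictTotalDegree ι k d ≤ (restrictTotalDegree ι k (d + e - 1)).comap
      (LinearMap.applyₗ r ∘ₗ D.envRep.toLinearMap ∘ₗ D.ordMon -
        (LinearMap.mul k (MvPolynomial ι k)).flip r) := by
    rw [restrictTotalDegree_le_iff]
    intro M hM
    have := restrictTotalDegree_mono (show M.degree + e - 1 ≤ d + e - 1 by omega)
      (D.envRep_ordProd_sub_mem M hr)
    rw [← ordMon_monomial] at this
    exact this
  exact this hp

/-- Combinations of ordered monomials act without torsion on `MvPolynomial ι k`. -/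
lemma envRep_ordMon_ne_zero [IsDomain k] {p r : MvPolynomial ι k} (hp : p ≠ 0) (hr : r ≠ 0) :
    D.envRep (D.ordMon p) r ≠ 0 := by
  intro h
  have h1 := D.envRep_ordMon_sub_mem (p := p) (r := r) (d := p.totalDegree) (e := r.totalDegree)
    (by rw [mem_restrictTotalDegree]) (by rw [mem_restrictTotalDegree])
  rw [h, zero_sub, neg_mem_iff, mem_restrictTotalDegree, totalDegree_mul_of_isDomain hp hr] at h1
  -- The product `p * r` would have degree below its own, unless the subtraction is truncated, that
  -- is, unless both degrees are zero. Then `p` is a constant and acts by a scalar.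
  have h2 : p.totalDegree = 0 := by
    omega
  obtain ⟨c, rfl⟩ : ∃ c, p = C c := ⟨_, totalDegree_eq_zero_iff_eq_C.mp h2⟩
  rw [← mul_one (C c), ← smul_eq_C_mul, map_smul, ordMon_one, map_smul, map_one] at h
  change c • r = 0 at h
  rw [smul_eq_C_mul] at h
  exact mul_ne_zero hp hr h

end PBWDatum

end DoubleAffine

namespace DoubleAffine

open LieAlgebra.IsKilling

/-! ### A weight basis of the loop algebra -/

section RootBasis

variable {𝔤 : Type*} [LieRing 𝔤] [LieAlgebra ℂ 𝔤] [FiniteDimensional ℂ 𝔤]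
  [LieAlgebra.IsSimple ℂ 𝔤] (H : LieSubalgebra ℂ 𝔤) [H.IsCartanSubalgebra]

/-- The index set of a basis of `𝔤` by weight vectors. -/
abbrev RootIdx : Type _ :=
  Σ χ : LieModule.Weight ℂ H 𝔤,
    Module.Basis.ofVectorSpaceIndex ℂ (LieModule.genWeightSpace 𝔤 χ).toSubmodule

/-- A basis of `𝔤` by weight vectors. -/
def rootBasis : Module.Basis (RootIdx H) ℂ 𝔤 := by
  classical
  exact (DirectSum.isInternal_submodule_of_iSupIndep_of_iSup_eq_top
    (A := fun χ : LieModule.Weight ℂ H 𝔤 => (LieModule.genWeightSpace 𝔤 χ).toSubmodule)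
    (LieSubmodule.iSupIndep_toSubmodule.mpr (LieModule.iSupIndep_genWeightSpace' ℂ H 𝔤))
    (by rw [← LieSubmodule.iSup_toSubmodule, LieModule.iSup_genWeightSpace_eq_top' ℂ H 𝔤,
      LieSubmodule.top_toSubmodule])).collectedBasis fun χ => Module.Basis.ofVectorSpace ℂ _

variable {H}

lemma rootBasis_mem (j : RootIdx H) : rootBasis H j ∈ LieModule.genWeightSpace 𝔤 j.1 := by
  classical
  exact DirectSum.IsInternal.collectedBasis_mem
    (A := fun χ : LieModule.Weight ℂ H 𝔤 => (LieModule.genWeightSpace 𝔤 χ).toSubmodule) _ _ j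

lemma lie_rootBasis (h : H) (j : RootIdx H) :
    ⁅(h : 𝔤), rootBasis H j⁆ = j.1 h • rootBasis H j :=
  lie_eq_smul_of_mem_rootSpace (rootBasis_mem j) h

lemma rootBasis_mem_of_isZero {j : RootIdx H} (hj : j.1.IsZero) : rootBasis H j ∈ H := by
  have h := rootBasis_mem j
  rw [hj] at h
  change _ ∈ LieAlgebra.rootSpace H 0 at h
  rwa [LieAlgebra.rootSpace_zero_eq] at h

/-- The existence of a root forces `H ≠ 0`. If all basis vectors had nonzero weight, each coordinate
of a nonzero `h ∈ H` would be scaled by a nonzero factor under some `g ∈ H`, contradicting `[g, h] =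
0`. -/
lemma exists_isZero (θ : H.root) : ∃ j : RootIdx H, j.1.IsZero := by
  by_contra! hc
  obtain ⟨h, hh⟩ : ∃ h : H, h ≠ 0 := by
    by_contra! h0
    refine (H.isNonZero_coe_root θ) ?_
    ext h
    simp [h0 h]
  have hr : ∀ j, (rootBasis H).repr (h : 𝔤) j = 0 := by
    intro j
    obtain ⟨g, hg⟩ : ∃ g : H, j.1 g ≠ 0 := by
      by_contra! h0
      exact hc j (funext h0)
    have key : ∀ x : 𝔤, (rootBasis H).repr ⁅(g : 𝔤), x⁆ j = j.1 g * (rootBasis H).repr x j := by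
      intro x
      have : (rootBasis H).coord j ∘ₗ (LieAlgebra.ad ℂ 𝔤 (g : 𝔤)) =
          j.1 g • (rootBasis H).coord j := by
        refine (rootBasis H).ext fun i => ?_
        by_cases hij : i = j
        · subst hij
          simp [lie_rootBasis]
        · simp [lie_rootBasis, hij]
      exact LinearMap.congr_fun this x
    have h1 := key h
    have h2 : ⁅(g : 𝔤), (h : 𝔤)⁆ = 0 := by
      rw [← LieSubalgebra.coe_bracket, trivial_lie_zero]; rfl
    rw [h2, map_zero] at h1
    exact (mul_eq_zero.mp h1.symm).resolve_left hg
  have h3 : (h : 𝔤) = 0 := (rootBasis H).ext_elem fun j => by rw [hr j]; simp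
  exact hh (Subtype.ext h3)

variable (H) in
/-- The index set of a basis of the `2`-loop algebra by weight vectors. -/
abbrev LoopIdx : Type _ := (Fin 2 → ℤ) × RootIdx H

variable (H) in
/-- A basis of the `2`-loop algebra by weight vectors. -/
def loopBasis : Module.Basis (LoopIdx H) ℂ (Loop₂ 𝔤) :=
  ((AddMonoidAlgebra.basis (Fin 2 → ℤ) ℂ).tensorProduct (rootBasis H) :
    Module.Basis (LoopIdx H) ℂ (Laurent₂ ⊗[ℂ] 𝔤))

lemma loopBasis_apply (p : LoopIdx H) : loopBasis H p = mono p.1 (rootBasis H p.2) := by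
  change ((AddMonoidAlgebra.basis (Fin 2 → ℤ) ℂ).tensorProduct (rootBasis H)) p = _
  rw [Module.Basis.tensorProduct_apply']
  rw [AddMonoidAlgebra.basis_apply]
  rfl

/-- The weight `α + m₁ δ₁ + m₂ δ₂` of a weight vector of the `2`-loop algebra. -/
def loopWt (p : LoopIdx H) : Module.Dual ℂ (Cartan H) :=
  extendDual p.2.1.toLinear + (p.1 0 : ℂ) • delta 0 + (p.1 1 : ℂ) • delta 1

lemma loopWt_apply (p : LoopIdx H) (h : Cartan H) :
    loopWt p h = p.2.1 h.1 + p.1 0 * h.2.2 0 + p.1 1 * h.2.2 1 := by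
  simp [loopWt, extendDual, delta]

lemma lie_loopBasis (h : Cartan H) (p : LoopIdx H) :
    ⁅mono 0 (h.1 : 𝔤), loopBasis H p⁆ + loopDer h.2.2 (loopBasis H p) =
      loopWt p h • loopBasis H p := by
  rw [loopBasis_apply, mono_lie, zero_add, lie_rootBasis, loopDer_apply, map_smul, loopWt_apply]
  simp only [Fin.sum_univ_two, loopDeg_mono, smul_smul, ← add_smul]
  congr 1
  ring

lemma repr_lie (h : Cartan H) (f : Loop₂ 𝔤) (p : LoopIdx H) :
    (loopBasis H).repr (⁅mono 0 (h.1 : 𝔤), f⁆ + loopDer h.2.2 f) p =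
      loopWt p h * (loopBasis H).repr f p := by
  have : (loopBasis H).coord p ∘ₗ
      ((LieAlgebra.ad ℂ (Loop₂ 𝔤) (mono 0 (h.1 : 𝔤)) : Module.End ℂ (Loop₂ 𝔤)) +
        loopDer h.2.2) = loopWt p h • (loopBasis H).coord p := by
    refine (loopBasis H).ext fun i => ?_
    rw [LinearMap.comp_apply, LinearMap.add_apply, LieAlgebra.ad_apply, lie_loopBasis, map_smul,
      LinearMap.smul_apply]
    by_cases hij : i = p
    · rw [hij]
    · simp [hij]
  exact LinearMap.congr_fun this f

variable (B : InvForm 𝔤)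

/-- The weight vectors of `𝔗` in the `2`-loop algebra. -/
def rtVec (p : LoopIdx H) : Toroidal B := Toroidal.mk B (loopBasis H p) 0 0

variable {B}

lemma rtVec_mem (p : LoopIdx H) : rtVec B p ∈ rtSpace B (loopWt p) := by
  intro h
  ext i
  · rw [loop_incl_lie]
    exact lie_loopBasis h p
  · rw [cen_incl_lie]
    simp [rtVec]
  · simp [rtVec]

lemma rtVec_ne_zero (p : LoopIdx H) : rtVec B p ≠ 0 := by
  intro h
  exact (loopBasis H).ne_zero p (congrArg Toroidal.loop h)

lemma rtSpace_loopWt_ne_bot (p : LoopIdx H) : rtSpace B (loopWt p) ≠ ⊥ := by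
  intro h
  have := rtVec_mem (B := B) p
  rw [h, Submodule.mem_bot] at this
  exact rtVec_ne_zero p this

lemma repr_eq_zero_of_mem_rtSpace {β : Module.Dual ℂ (Cartan H)} {x : Toroidal B}
    (hx : x ∈ rtSpace B β) {p : LoopIdx H} (hp : loopWt p ≠ β) :
    (loopBasis H).repr x.loop p = 0 := by
  obtain ⟨h, hh⟩ : ∃ h, loopWt p h ≠ β h := by
    by_contra! hc
    exact hp (LinearMap.ext hc)
  have h1 := repr_lie h x.loop p
  have h2 := congrArg Toroidal.loop (hx h)
  rw [loop_incl_lie] at h2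
  rw [h2, map_smul, map_smul, Finsupp.smul_apply, smul_eq_mul] at h1
  have h3 : (loopWt p h - β h) * (loopBasis H).repr x.loop p = 0 := by
    linear_combination -h1
  exact (mul_eq_zero.mp h3).resolve_left (sub_ne_zero.mpr hh)

lemma repr_eq_zero_of_mem_rtSum {S : Set (Module.Dual ℂ (Cartan H))} {x : Toroidal B}
    (hx : x ∈ rtSum B S) {p : LoopIdx H} (hp : loopWt p ∉ S) :
    (loopBasis H).repr x.loop p = 0 := by
  refine rtSum_induction (p := fun x : Toroidal B => (loopBasis H).repr x.loop p = 0) hx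
    (fun β hβ y hy => repr_eq_zero_of_mem_rtSpace hy ?_) (by simp) (fun y z hy hz => ?_)
  · rintro rfl
    exact hp hβ
  · rw [map_add, map_add, Finsupp.add_apply, hy, hz, add_zero]

lemma cen_der_eq_zero_of_mem_rtSum {S : Set (Module.Dual ℂ (Cartan H))} (h0 : 0 ∉ S)
    {x : Toroidal B} (hx : x ∈ rtSum B S) : x.cen = 0 ∧ x.der = 0 := by
  refine rtSum_induction (p := fun x : Toroidal B => x.cen = 0 ∧ x.der = 0) hx
    (fun β hβ y hy => ?_) (by simp) (fun y z hy hz => ?_)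
  · obtain ⟨h, hh⟩ : ∃ h, β h ≠ 0 := by
      by_contra! hc
      exact h0 ((LinearMap.ext hc : β = 0) ▸ hβ)
    constructor
    · have := congrArg Toroidal.cen (hy h)
      rw [cen_incl_lie, map_smul] at this
      exact (smul_eq_zero.mp this.symm).resolve_left hh
    · have := congrArg Toroidal.der (hy h)
      rw [Toroidal.der_lie, map_smul] at this
      exact (smul_eq_zero.mp this.symm).resolve_left hh
  · rw [map_add, map_add, hy.1, hy.2, hz.1, hz.2]
    simp

end RootBasis

/-! ### Values of `φ` and the triangular decomposition -/

section Triangular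

variable {𝔤 : Type*} [LieRing 𝔤] [LieAlgebra ℂ 𝔤] [FiniteDimensional ℂ 𝔤]
  [LieAlgebra.IsSimple ℂ 𝔤] {H : LieSubalgebra ℂ 𝔤} [H.IsCartanSubalgebra]
  (b : (rootSystem H).Base) (θ : H.root) (B : InvForm 𝔤)

lemma height_neg_le (hθ : ∀ α : H.root, b.height α ≤ b.height θ) (α : H.root) :
    -b.height θ ≤ b.height α := by
  let _ := (rootSystem H).indexNeg
  have h := hθ (-α)
  rw [b.height_reflectionPerm_self] at h
  omega

/-- In coordinates, `φ` is the sum of the coweights plus `(1 + ht θ) d₁`: the multiple of `α_{-1}^*`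
is chosen to cancel the `d₂` component. -/
lemma loopWt_phi_of_isZero {p : LoopIdx H} (hp : p.2.1.IsZero) :
    loopWt p (phi b θ) = (p.1 0 * (1 + b.height θ) : ℤ) := by
  have h := sum_root_coweight b θ
  have h0 : (p.2.1 : H → ℂ) = 0 := hp
  rw [loopWt_apply, h0]
  simp only [phi, Fintype.sum_option, dualElt]
  simp only [rootSystem_root_apply, Finset.univ_eq_attach, LieModule.Weight.toLinear_apply] at h
  simp [Prod.snd_sum, h]

lemma loopWt_phi_of_root {p : LoopIdx H} (α : H.root) (hp : p.2.1 = α) :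
    loopWt p (phi b θ) = (b.height α + p.1 0 * (1 + b.height θ) : ℤ) := by
  have h := sum_root_coweight b θ
  have h' := sum_root_coweight b α
  rw [loopWt_apply, hp]
  simp only [rootSystem_root_apply, LieModule.Weight.toLinear_apply] at h h'
  have h1 : (phi b θ).1 = ∑ i, coweight b i := by
    simp [phi, Fintype.sum_option, dualElt, Prod.fst_sum]
  have h2 : (α.1 : H → ℂ) (phi b θ).1 = b.height α := by
    rw [h1, ← h', ← LieModule.Weight.toLinear_apply, map_sum]
    rfl
  rw [Finset.univ_eq_attach] at h
  rw [h2]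
  simp [phi, Fintype.sum_option, dualElt, Prod.snd_sum, h]

lemma isZero_or_root (χ : LieModule.Weight ℂ H 𝔤) : χ.IsZero ∨ ∃ α : H.root, χ = α := by
  by_cases h : χ.IsZero
  · exact Or.inl h
  · exact Or.inr ⟨⟨χ, by simpa using h⟩, rfl⟩

lemma exists_int_loopWt_phi (p : LoopIdx H) : ∃ n : ℤ, loopWt p (phi b θ) = n := by
  rcases isZero_or_root p.2.1 with h | ⟨α, h⟩
  · exact ⟨_, loopWt_phi_of_isZero b θ h⟩
  · exact ⟨_, loopWt_phi_of_root b θ α h⟩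

lemma height_pos (hθ : ∀ α : H.root, b.height α ≤ b.height θ) : 0 < b.height θ := by
  have h1 := height_neg_le b θ hθ θ
  have h2 := b.height_ne_zero θ
  omega

variable {b θ} in
-- A root has nonzero height of absolute value less than `1 + ht θ`, so adding a multiple of `1 + ht
-- θ` never gives zero.
lemma eq_of_loopWt_phi_eq_zero (hθ : ∀ α : H.root, b.height α ≤ b.height θ) {p : LoopIdx H}
    (hp : loopWt p (phi b θ) = 0) : p.2.1.IsZero ∧ p.1 0 = 0 := by
  have hpos := height_pos b θ hθ
  rcases isZero_or_root p.2.1 with h | ⟨α, h⟩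
  · rw [loopWt_phi_of_isZero b θ h] at hp
    refine ⟨h, ?_⟩
    have hp' : p.1 0 * (1 + b.height θ) = 0 := by exact_mod_cast hp
    rcases mul_eq_zero.mp hp' with h | h
    · exact h
    · omega
  · rw [loopWt_phi_of_root b θ α h] at hp
    have hp' : b.height α + p.1 0 * (1 + b.height θ) = 0 := by exact_mod_cast hp
    have h1 := hθ α
    have h2 := height_neg_le b θ hθ α
    have h3 := b.height_ne_zero α
    exfalso
    rcases lt_trichotomy (p.1 0) 0 with h4 | h4 | h4
    · nlinarith
    · rw [h4] at hp'
      omega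
    · nlinarith

lemma loopWt_eq_of_isZero {p : LoopIdx H} (h : p.2.1.IsZero) (h0 : p.1 0 = 0) :
    loopWt p = p.1 1 • delta 1 := by
  ext g <;> simp [loopWt_apply, h0, delta, h.eq]

variable {b θ} in
-- The sign of the integer `φ`-value decides; when it is zero the weight is an integer multiple of
-- `δ₂`, and the sign of that integer decides.
lemma loopWt_cases (hθ : ∀ α : H.root, b.height α ≤ b.height θ) (p : LoopIdx H) :
    loopWt p = 0 ∨ loopWt p ∈ posSet b θ B ∨ loopWt p ∈ negSet b θ B := by
  obtain ⟨n, hn⟩ := exists_int_loopWt_phi b θ p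
  have hne : ∀ β : Module.Dual ℂ (Cartan H), β (phi b θ) ≠ 0 → β ≠ 0 := by
    rintro _ h rfl
    simp at h
  rcases lt_trichotomy n 0 with h | h | h
  · refine Or.inr (Or.inr (Or.inl ⟨⟨?_, ?_⟩, ?_⟩))
    · refine neg_ne_zero.mpr (hne _ ?_)
      rw [hn]
      exact_mod_cast h.ne
    · exact rtSpace_neg_ne_bot (hne _ (by rw [hn]; exact_mod_cast h.ne)) (rtSpace_loopWt_ne_bot p)
    · rw [LinearMap.neg_apply, hn]
      simpa using h
  · rw [h, Int.cast_zero] at hn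
    obtain ⟨h1, h2⟩ := eq_of_loopWt_phi_eq_zero hθ hn
    rw [loopWt_eq_of_isZero h1 h2]
    rcases lt_trichotomy (p.1 1) 0 with h3 | h3 | h3
    · refine Or.inr (Or.inr (Or.inr ⟨(-p.1 1).toNat, by omega, ?_⟩))
      rw [← neg_smul, ← natCast_zsmul, Int.toNat_of_nonneg (by omega)]
    · exact Or.inl (by rw [h3, zero_smul])
    · refine Or.inr (Or.inl (Or.inr ⟨(p.1 1).toNat, by omega, ?_⟩))
      rw [← natCast_zsmul, Int.toNat_of_nonneg (by omega)]
  · refine Or.inr (Or.inl (Or.inl ⟨⟨?_, rtSpace_loopWt_ne_bot p⟩, ?_⟩))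
    · refine hne _ ?_
      rw [hn]
      exact_mod_cast h.ne'
    · rw [hn]
      simpa using h

lemma zero_notMem_negSet : (0 : Module.Dual ℂ (Cartan H)) ∉ negSet b θ B := fun h =>
  ne_zero_of_mem_posSet b θ h neg_zero

variable {b θ B} in
lemma notMem_negSet_of_mem_posSet {β : Module.Dual ℂ (Cartan H)} (h : β ∈ posSet b θ B) :
    β ∉ negSet b θ B := fun h' =>
  add_ne_zero_of_mem_posSet b θ h h' (add_neg_cancel β)

/-- The indices of the weight vectors spanning `𝔗_{-𝓘}`. -/
def negIdx : Set (LoopIdx H) := {p | loopWt p ∈ negSet b θ B}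

/-- The coordinates of the component in `𝔗_{-𝓘}`. -/
def negCoord : Toroidal B →ₗ[ℂ] (negIdx b θ B →₀ ℂ) :=
  Finsupp.lsubtypeDomain (negIdx b θ B) ∘ₗ (loopBasis H).repr.toLinearMap ∘ₗ Toroidal.loop

lemma negCoord_apply (x : Toroidal B) (p : negIdx b θ B) :
    negCoord b θ B x p = (loopBasis H).repr x.loop p := rfl

lemma negCoord_rtVec (p : negIdx b θ B) : negCoord b θ B (rtVec B p.1) = Finsupp.single p 1 := by
  ext q
  rw [negCoord_apply, rtVec, Toroidal.loop_mk, Module.Basis.repr_self]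
  exact Finsupp.single_apply_left Subtype.val_injective _ _ _

lemma repr_mono_zero (h : H) {p : LoopIdx H} (hp : loopWt p ≠ 0) :
    (loopBasis H).repr (mono 0 (h : 𝔤)) p = 0 := by
  obtain ⟨g, hg⟩ : ∃ g, loopWt p g ≠ 0 := by
    by_contra! hc
    exact hp (LinearMap.ext hc)
  have h1 := repr_lie g (mono 0 (h : 𝔤)) p
  have h2 : ⁅(g.1 : 𝔤), (h : 𝔤)⁆ = 0 := by
    rw [← LieSubalgebra.coe_bracket, trivial_lie_zero]; rfl
  rw [mono_lie, h2, loopDer_apply] at h1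
  simp only [loopDeg_mono_zero, map_zero, smul_zero, Finset.sum_const_zero, add_zero] at h1
  exact (mul_eq_zero.mp h1.symm).resolve_left hg

variable {b θ B} in
-- By `loopWt_cases`, a weight vector with weight outside `-𝓘` lies in `𝔥̂` or in `𝔗_𝓘`. Conversely,
-- these two have no coordinates at weights in `-𝓘`, as `0` and `𝓘` are disjoint from it.
lemma negCoord_eq_zero_iff (hθ : ∀ α : H.root, b.height α ≤ b.height θ) (x : Toroidal B) :
    negCoord b θ B x = 0 ↔ x ∈ borel b θ B := by
  constructor
  · intro hx
    have hr : ∀ p : LoopIdx H, loopWt p ∈ negSet b θ B → (loopBasis H).repr x.loop p = 0 :=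
      fun p hp => DFunLike.congr_fun hx (⟨p, hp⟩ : negIdx b θ B)
    have hsum : x.loop = ((loopBasis H).repr x.loop).sum fun p r => r • loopBasis H p :=
      ((loopBasis H).linearCombination_repr x.loop).symm
    have hx' : x = (((loopBasis H).repr x.loop).sum fun p r => r • rtVec B p) +
        Cartan.incl B ((0, x.cen, x.der) : Cartan H) := by
      have h1 : ∀ f : LoopIdx H →₀ ℂ, (f.sum fun p r => r • rtVec B p) =
          Toroidal.mk B (f.sum fun p r => r • loopBasis H p) 0 0 := by
        intro f
        refine Toroidal.ext ?_ ?_ ?_ <;> simp [Finsupp.sum, rtVec, map_sum]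
      rw [h1, ← hsum]
      ext <;> simp
    rw [hx']
    refine add_mem (sum_mem fun p _ => ?_) (Submodule.mem_sup_left ⟨_, rfl⟩)
    rcases loopWt_cases B hθ p with h | h | h
    · refine (borel b θ B).smul_mem _ (Submodule.mem_sup_left ?_)
      have hz : p.2.1.IsZero := by
        funext g
        simpa [loopWt_apply] using LinearMap.congr_fun h (g, 0, 0)
      have hm : p.1 = 0 := by
        funext i
        have := LinearMap.congr_fun h (0, 0, Pi.single i 1)
        rw [loopWt_apply] at this
        fin_cases i <;> simpa using this
      refine ⟨(⟨rootBasis H p.2, rootBasis_mem_of_isZero hz⟩, 0, 0), ?_⟩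
      ext
      · rw [loop_incl, rtVec, Toroidal.loop_mk, loopBasis_apply, hm]
      · simp [rtVec]
      · simp [rtVec]
    · exact (borel b θ B).smul_mem _ (Submodule.mem_sup_right (rtSpace_le_rtSum h (rtVec_mem p)))
    · change (loopBasis H).repr x.loop p • rtVec B p ∈ borel b θ B
      rw [hr p h, zero_smul]
      exact zero_mem _
  · intro hx
    obtain ⟨_, ⟨h, rfl⟩, y, hy, rfl⟩ := Submodule.mem_sup.mp hx
    ext p
    have hp0 : loopWt p.1 ≠ 0 := fun h0 => zero_notMem_negSet b θ B (h0 ▸ p.2)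
    rw [negCoord_apply, map_add, map_add, Finsupp.add_apply, loop_incl, repr_mono_zero _ hp0,
      repr_eq_zero_of_mem_rtSum hy (fun h => notMem_negSet_of_mem_posSet h p.2)]
    simp

lemma projCartan_rtVec (p : negIdx b θ B) : projCartan H B (rtVec B p.1) = 0 := by
  obtain ⟨g, hg⟩ : ∃ g, loopWt p.1 g ≠ 0 := by
    by_contra! hc
    exact zero_notMem_negSet b θ B ((LinearMap.ext hc : loopWt p.1 = 0) ▸ p.2)
  have h := projCartan_incl_lie B g (rtVec B p.1)
  rw [rtVec_mem p.1 g, map_smul] at h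
  exact (smul_eq_zero.mp h).resolve_left hg

lemma rtVec_mem_nNeg (p : negIdx b θ B) : rtVec B p.1 ∈ nNeg b θ B :=
  rtSpace_le_rtSum (S := negSet b θ B) p.2 (rtVec_mem p.1)

variable {b θ B} in
lemma eq_zero_of_negCoord {x : Toroidal B} (hx : x ∈ nNeg b θ B) (h : negCoord b θ B x = 0) :
    x = 0 := by
  have hx' : x ∈ rtSum B (negSet b θ B) := hx
  obtain ⟨h1, h2⟩ := cen_der_eq_zero_of_mem_rtSum (zero_notMem_negSet b θ B) hx'
  refine Toroidal.ext ?_ (by rw [h1, map_zero]) (by rw [h2, map_zero])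
  refine (loopBasis H).ext_elem fun p => ?_
  rw [map_zero, map_zero, Finsupp.zero_apply]
  by_cases hp : loopWt p ∈ negSet b θ B
  · exact DFunLike.congr_fun h (⟨p, hp⟩ : negIdx b θ B)
  · exact repr_eq_zero_of_mem_rtSum hx' hp

end Triangular

end DoubleAffine

namespace DoubleAffine

open LieAlgebra.IsKilling MvPolynomial

attribute [local instance 100] LieRing.ofAssociativeRing

/-! ### The monomial basis of the imaginary Verma module and its consequences -/

section VermaBasis

variable {𝔤 : Type*} [LieRing 𝔤] [LieAlgebra ℂ 𝔤] [FiniteDimensional ℂ 𝔤]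
  [LieAlgebra.IsSimple ℂ 𝔤] {H : LieSubalgebra ℂ 𝔤} [H.IsCartanSubalgebra]
  (b : (rootSystem H).Base) (θ : H.root) (B : InvForm 𝔤) (lam : Module.Dual ℂ (Cartan H))

namespace Verma

lemma exists_smul_gen (w : Verma b θ B lam) :
    ∃ u : UniversalEnvelopingAlgebra ℂ (Toroidal B), u • gen b θ B lam = w := by
  obtain ⟨t, rfl⟩ := Submodule.Quotient.mk_surjective _ w
  induction t using TensorProduct.induction_on with
  | zero => exact ⟨0, by rw [zero_smul]; rfl⟩
  | tmul u z =>
    refine ⟨z • u, ?_⟩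
    change Submodule.Quotient.mk ((z • u) • ((1 : UniversalEnvelopingAlgebra ℂ (Toroidal B))
      ⊗ₜ[ℂ] (1 : ℂ))) = _
    rw [TensorProduct.smul_tmul', smul_eq_mul, mul_one, TensorProduct.smul_tmul, smul_eq_mul,
      mul_one]
  | add s t hs ht =>
    obtain ⟨u, hu⟩ := hs
    obtain ⟨u', hu'⟩ := ht
    exact ⟨u + u', by rw [add_smul, hu, hu']; rfl⟩

lemma borel_smul_gen (y : Toroidal B) (hy : y ∈ borel b θ B) :
    UniversalEnvelopingAlgebra.ι ℂ y • gen b θ B lam =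
      lam (projCartan H B y) • gen b θ B lam := by
  have h : (1 * envMap (borel b θ B) (UniversalEnvelopingAlgebra.ι ℂ ⟨y, hy⟩)) ⊗ₜ[ℂ] (1 : ℂ) -
      1 ⊗ₜ[ℂ] (UniversalEnvelopingAlgebra.lift ℂ (borelRep b θ B lam)
        (UniversalEnvelopingAlgebra.ι ℂ ⟨y, hy⟩) 1) ∈
      inducedRel (borel b θ B) (borelRep b θ B lam) :=
    Submodule.subset_span ⟨_, _, _, rfl⟩
  rw [UniversalEnvelopingAlgebra.lift_ι_apply, envMap, UniversalEnvelopingAlgebra.lift_ι_apply,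
    one_mul] at h
  have h' := (Submodule.Quotient.eq _).mpr h
  have h1 : UniversalEnvelopingAlgebra.ι ℂ y • gen b θ B lam =
      Submodule.Quotient.mk ((UniversalEnvelopingAlgebra.ι ℂ y) ⊗ₜ[ℂ] (1 : ℂ)) := by
    change Submodule.Quotient.mk (UniversalEnvelopingAlgebra.ι ℂ y •
      ((1 : UniversalEnvelopingAlgebra ℂ (Toroidal B)) ⊗ₜ[ℂ] (1 : ℂ))) = _
    rw [TensorProduct.smul_tmul', smul_eq_mul, mul_one]
  rw [h1]
  refine h'.trans ?_
  change Submodule.Quotient.mk (1 ⊗ₜ[ℂ] (lam (projCartan H B y) • (1 : ℂ))) =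
    Submodule.Quotient.mk (lam (projCartan H B y) • (1 ⊗ₜ[ℂ] (1 : ℂ)))
  rw [TensorProduct.tmul_smul]

/-- The relation at `v` extends from `𝔟_𝓘` to `U(𝔟_𝓘)`, so `u ⊗ z ↦ z u v` respects the balancing
relations. Only an action of `U(𝔗)` is required, so this serves both the polynomial model and
arbitrary `𝔗`-modules. -/
lemma exists_lift {V : Type*} [AddCommGroup V] [Module ℂ V]
    (A : UniversalEnvelopingAlgebra ℂ (Toroidal B) →ₐ[ℂ] Module.End ℂ V) (v : V)
    (hv : ∀ y ∈ borel b θ B,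
      A (UniversalEnvelopingAlgebra.ι ℂ y) v = lam (projCartan H B y) • v) :
    ∃ f : Verma b θ B lam →ₗ[ℂ] V, ∀ u, f (u • gen b θ B lam) = A u v := by
  let _ : Module (UniversalEnvelopingAlgebra ℂ (Toroidal B)) V := Module.compHom V A.toRingHom
  have hsmul : ∀ (u : UniversalEnvelopingAlgebra ℂ (Toroidal B)) (w : V), u • w = A u w :=
    fun _ _ => rfl
  have _ : IsScalarTower ℂ (UniversalEnvelopingAlgebra ℂ (Toroidal B)) V :=
    ⟨fun r u w => by rw [hsmul, hsmul, map_smul, LinearMap.smul_apply]⟩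
  let g : UniversalEnvelopingAlgebra ℂ (Toroidal B) ⊗[ℂ] ℂ
      →ₗ[UniversalEnvelopingAlgebra ℂ (Toroidal B)] V :=
    (LinearMap.toSpanSingleton (UniversalEnvelopingAlgebra ℂ (Toroidal B)) V v) ∘ₗ
      (TensorProduct.AlgebraTensorModule.rid ℂ (UniversalEnvelopingAlgebra ℂ (Toroidal B))
        (UniversalEnvelopingAlgebra ℂ (Toroidal B))).toLinearMap
  have hg : ∀ u z, g (u ⊗ₜ z) = z • A u v := by
    intro u z
    simp [g, hsmul]
  have hb : ∀ (a : UniversalEnvelopingAlgebra ℂ (borel b θ B)) (z : ℂ),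
      z • A (envMap (borel b θ B) a) v =
        UniversalEnvelopingAlgebra.lift ℂ (borelRep b θ B lam) a z • v := by
    intro a
    induction a using env_induction with
    | halg r =>
      intro z
      rw [AlgHom.commutes, AlgHom.commutes, AlgHom.commutes, Module.algebraMap_end_apply,
        Module.algebraMap_end_apply, smul_comm, smul_assoc]
    | hι y =>
      intro z
      rw [envMap, UniversalEnvelopingAlgebra.lift_ι_apply, UniversalEnvelopingAlgebra.lift_ι_apply]
      change z • A (UniversalEnvelopingAlgebra.ι ℂ (y : Toroidal B)) v =
        (lam (projCartan H B y) • z) • v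
      rw [hv y y.2, smul_comm, smul_assoc]
    | hmul a c ha hc =>
      intro z
      rw [map_mul, map_mul, map_mul, Module.End.mul_apply, Module.End.mul_apply, ← map_smul, hc,
        map_smul, ha]
    | hadd a c ha hc =>
      intro z
      rw [map_add, map_add, map_add, LinearMap.add_apply, LinearMap.add_apply, smul_add, ha, hc,
        add_smul]
  have hker : inducedRel (borel b θ B) (borelRep b θ B lam) ≤ LinearMap.ker g := by
    rw [inducedRel, Submodule.span_le]
    rintro _ ⟨u, a, z, rfl⟩
    rw [SetLike.mem_coe, LinearMap.mem_ker, map_sub, hg, hg, map_mul, Module.End.mul_apply,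
      ← map_smul, hb, map_smul, sub_self]
  let f : Verma b θ B lam →ₗ[UniversalEnvelopingAlgebra ℂ (Toroidal B)] V :=
    Submodule.liftQ _ g hker
  refine ⟨f.restrictScalars ℂ, fun u => ?_⟩
  have hf : f (gen b θ B lam) = v := by
    change g (1 ⊗ₜ 1) = v
    rw [hg, map_one, one_smul]
    rfl
  change f (u • gen b θ B lam) = A u v
  rw [map_smul, hf, hsmul]

end Verma

/-- A well-order of the indices of the weight vectors of `𝔗_{-𝓘}`. -/
instance negIdx.linearOrder : LinearOrder (negIdx b θ B) := IsWellOrder.linearOrder WellOrderingRel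

variable {b θ}
variable (hθ : ∀ α : H.root, b.height α ≤ b.height θ)

/-- The decomposition `𝔗 = 𝔗_{-𝓘} ⊕ 𝔟_𝓘` with the character `λ` of `𝔟_𝓘`. -/
def vermaDatum : PBWDatum ℂ (Toroidal B) (negIdx b θ B) where
  vec p := rtVec B p.1
  coord := negCoord b θ B
  coord_vec := negCoord_rtVec b θ B
  char := lam ∘ₗ projCartan H B
  char_vec p := by rw [LinearMap.comp_apply, projCartan_rtVec, map_zero]
  coord_lie x y hx hy := by
    rw [negCoord_eq_zero_iff hθ] at hx hy ⊢
    exact (borel b θ B).lie_mem hx hy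
  char_lie x y hx hy := by
    rw [negCoord_eq_zero_iff hθ] at hx hy
    rw [LinearMap.comp_apply, projCartan_nPos b θ (lie_mem_nPos_of_mem b θ hx hy), map_zero]

variable (b θ) in
/-- The basis of `𝔗_{-𝓘}` by weight vectors. -/
def negDatum : PBWDatum ℂ (nNeg b θ B) (negIdx b θ B) where
  vec p := ⟨rtVec B p.1, rtVec_mem_nNeg b θ B p⟩
  coord := negCoord b θ B ∘ₗ (nNeg b θ B).subtype
  coord_vec p := negCoord_rtVec b θ B p
  char := 0
  char_vec p := rfl
  coord_lie x y hx _ := by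
    have : x = 0 := Subtype.ext (eq_zero_of_negCoord x.2 hx)
    rw [this, zero_lie, map_zero]
  char_lie _ _ _ _ := rfl

lemma ker_smul_gen (y : Toroidal B) (hy : (vermaDatum B lam hθ).coord y = 0) :
    UniversalEnvelopingAlgebra.ι ℂ y • Verma.gen b θ B lam =
      (vermaDatum B lam hθ).char y • Verma.gen b θ B lam :=
  Verma.borel_smul_gen b θ B lam y ((negCoord_eq_zero_iff hθ y).mp hy)

/-- The map `p ↦ p (1 ⊗ 1_λ)` with `p` a combination of ordered monomials in `𝔗_{-𝓘}`. -/
def vermaMap : MvPolynomial (negIdx b θ B) ℂ →ₗ[ℂ] Verma b θ B lam where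
  toFun p := (vermaDatum B lam hθ).ordMon p • Verma.gen b θ B lam
  map_add' p q := by rw [map_add, add_smul]
  map_smul' r p := by rw [map_smul, smul_assoc, RingHom.id_apply]

lemma vermaMap_apply (p : MvPolynomial (negIdx b θ B) ℂ) :
    vermaMap B lam hθ p = (vermaDatum B lam hθ).ordMon p • Verma.gen b θ B lam := rfl

/-- In the polynomial model `𝔟_𝓘` acts on `1` through `λ`, so `M̄(λ)` maps to it equivariantly with
the generator going to `1`. -/
lemma exists_vermaMap_leftInverse :
    ∃ f : Verma b θ B lam →ₗ[ℂ] MvPolynomial (negIdx b θ B) ℂ,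
      (∀ p, f (vermaMap B lam hθ p) = p) ∧
      ∀ u w, f (u • w) = (vermaDatum B lam hθ).envRep u (f w) := by
  obtain ⟨f, hf⟩ := Verma.exists_lift b θ B lam (vermaDatum B lam hθ).envRep 1 (fun y hy => by
    rw [PBWDatum.envRep_ι, PBWDatum.act_one_of_coord_eq_zero _
      ((negCoord_eq_zero_iff hθ y).mpr hy), ← mul_one (C _), ← smul_eq_C_mul]
    rfl)
  refine ⟨f, fun p => ?_, fun u w => ?_⟩
  · rw [vermaMap_apply, hf, PBWDatum.envRep_ordMon_one]
  · obtain ⟨a, rfl⟩ := Verma.exists_smul_gen b θ B lam w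
    rw [← mul_smul, hf, hf, map_mul, Module.End.mul_apply]

lemma vermaMap_envRep_one (u : UniversalEnvelopingAlgebra ℂ (Toroidal B)) :
    vermaMap B lam hθ ((vermaDatum B lam hθ).envRep u 1) = u • Verma.gen b θ B lam := by
  rw [vermaMap_apply, PBWDatum.ordMon_envRep_smul _ (ker_smul_gen B lam hθ), PBWDatum.ordMon_one,
    one_smul]

lemma vermaMap_bijective : Function.Bijective (vermaMap B lam hθ) := by
  constructor
  · obtain ⟨f, hf, -⟩ := exists_vermaMap_leftInverse B lam hθ
    exact Function.LeftInverse.injective hf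
  · intro w
    obtain ⟨u, rfl⟩ := Verma.exists_smul_gen b θ B lam w
    exact ⟨_, vermaMap_envRep_one B lam hθ u⟩

/-- The basis of ordered monomials of the imaginary Verma module. -/
def vermaBasis : Module.Basis (negIdx b θ B →₀ ℕ) ℂ (Verma b θ B lam) :=
  (basisMonomials (negIdx b θ B) ℂ).map (LinearEquiv.ofBijective _ (vermaMap_bijective B lam hθ))

lemma vermaBasis_apply (M : negIdx b θ B →₀ ℕ) :
    vermaBasis B lam hθ M = (vermaDatum B lam hθ).ordProd M • Verma.gen b θ B lam := by
  rw [vermaBasis, Module.Basis.map_apply, coe_basisMonomials]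
  change vermaMap B lam hθ (monomial M 1) = _
  rw [vermaMap_apply, PBWDatum.ordMon_monomial]

lemma vermaBasis_zero : vermaBasis B lam hθ 0 = Verma.gen b θ B lam := by
  rw [vermaBasis_apply, PBWDatum.ordProd_zero, one_smul]

lemma gen_ne_zero (hθ : ∀ α : H.root, b.height α ≤ b.height θ) : Verma.gen b θ B lam ≠ 0 := by
  rw [← vermaBasis_zero B lam hθ]
  exact (vermaBasis B lam hθ).ne_zero 0

/-- The weight of an ordered monomial. -/
def monWt : (negIdx b θ B →₀ ℕ) →+ Module.Dual ℂ (Cartan H) :=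
  Finsupp.liftAddHom fun p => (multiplesHom _) (loopWt p.1)

lemma monWt_single (p : negIdx b θ B) (n : ℕ) :
    monWt B (Finsupp.single p n) = n • loopWt p.1 := by
  simp [monWt]

lemma vermaBasis_mem (M : negIdx b θ B →₀ ℕ) :
    vermaBasis B lam hθ M ∈ wtSpace B (Verma b θ B lam) (lam + monWt B M) := by
  rw [vermaBasis_apply]
  induction M using PBWDatum.induction_min with
  | h0 =>
    rw [PBWDatum.ordProd_zero, one_smul, map_zero, add_zero]
    intro h
    change UniversalEnvelopingAlgebra.ι ℂ _ • _ = _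
    rw [Verma.borel_smul_gen _ _ _ _ _ (Submodule.mem_sup_left ⟨h, rfl⟩), projCartan_incl]
  | h1 p P hP ih =>
    rw [PBWDatum.ordProd_single_add _ hP, mul_smul]
    intro h
    change ⁅Cartan.incl B h, ⁅rtVec B p.1, (vermaDatum B lam hθ).ordProd P •
      Verma.gen b θ B lam⁆⁆ = _ • ⁅rtVec B p.1, (vermaDatum B lam hθ).ordProd P •
      Verma.gen b θ B lam⁆
    rw [leibniz_lie, ih h, rtVec_mem p.1 h, smul_lie, lie_smul, ← add_smul, map_add, monWt_single,
      one_smul]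
    congr 1
    simp only [LinearMap.add_apply]
    ring

lemma isImHighestVector_gen (hθ : ∀ α : H.root, b.height α ≤ b.height θ) :
    IsImHighestVector b θ B lam (Verma.gen b θ B lam) where
  ne_zero := gen_ne_zero B lam hθ
  pos_lie x hx := by
    change UniversalEnvelopingAlgebra.ι ℂ x • _ = _
    rw [Verma.borel_smul_gen _ _ _ _ _ (Submodule.mem_sup_right hx), projCartan_nPos b θ hx,
      map_zero, zero_smul]
  weight := by
    have := vermaBasis_mem B lam hθ 0
    rwa [vermaBasis_zero, map_zero, add_zero] at this

/-- Ordered products involve only vectors of `𝔗_{-𝓘}` and so do not depend on `λ`. This links the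
bases of `U(𝔗_{-𝓘})` and `M̄(λ)`, and also the Verma modules of different highest weights. -/
lemma envMap_negDatum_ordProd (M : negIdx b θ B →₀ ℕ) :
    envMap (nNeg b θ B) ((negDatum b θ B).ordProd M) = (vermaDatum B lam hθ).ordProd M := by
  rw [PBWDatum.ordProd, PBWDatum.ordProd, map_list_prod, List.map_map]
  congr 2
  funext p
  exact UniversalEnvelopingAlgebra.lift_ι_apply ℂ _ _

lemma envMap_negDatum_ordMon (p : MvPolynomial (negIdx b θ B) ℂ) :
    envMap (nNeg b θ B) ((negDatum b θ B).ordMon p) = (vermaDatum B lam hθ).ordMon p := by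
  have : (envMap (nNeg b θ B)).toLinearMap ∘ₗ (negDatum b θ B).ordMon =
      (vermaDatum B lam hθ).ordMon := by
    refine (basisMonomials _ ℂ).ext fun M => ?_
    rw [coe_basisMonomials]
    change envMap (nNeg b θ B) ((negDatum b θ B).ordMon (monomial M 1)) =
      (vermaDatum B lam hθ).ordMon (monomial M 1)
    rw [PBWDatum.ordMon_monomial, PBWDatum.ordMon_monomial, envMap_negDatum_ordProd]
  exact LinearMap.congr_fun this p

/-- Ordered products identify both `U(𝔗_{-𝓘})` and `M̄(λ)` with the same polynomial space, and
acting on the generator is the composite identification. -/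
lemma smul_gen_bijective (hθ : ∀ α : H.root, b.height α ≤ b.height θ) : Function.Bijective
    fun u : UniversalEnvelopingAlgebra ℂ (nNeg b θ B) => u • Verma.gen b θ B lam := by
  have hone : ∀ u, (negDatum b θ B).ordMon ((negDatum b θ B).envRep u 1) = u :=
    PBWDatum.ordMon_envRep_one _ fun x hx => Subtype.ext (eq_zero_of_negCoord x.2 hx)
  have h : (fun u : UniversalEnvelopingAlgebra ℂ (nNeg b θ B) => u • Verma.gen b θ B lam) =
      vermaMap B lam hθ ∘ fun u => (negDatum b θ B).envRep u 1 := by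
    funext u
    rw [Function.comp_apply, vermaMap_apply, ← envMap_negDatum_ordMon, hone]
    rfl
  rw [h]
  refine (vermaMap_bijective B lam hθ).comp ⟨Function.LeftInverse.injective hone, fun p => ?_⟩
  exact ⟨_, (negDatum b θ B).envRep_ordMon_one p⟩

lemma exists_basis_gen (hθ : ∀ α : H.root, b.height α ≤ b.height θ) :
    ∃ e : Module.Basis Unit (UniversalEnvelopingAlgebra ℂ (nNeg b θ B)) (Verma b θ B lam),
      e () = Verma.gen b θ B lam := by
  refine ⟨(Module.Basis.singleton Unit _).map (LinearEquiv.ofBijective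
    (LinearMap.toSpanSingleton (UniversalEnvelopingAlgebra ℂ (nNeg b θ B)) _
      (Verma.gen b θ B lam)) (smul_gen_bijective B lam hθ)), ?_⟩
  rw [Module.Basis.map_apply, Module.Basis.singleton_apply]
  exact one_smul (UniversalEnvelopingAlgebra ℂ (nNeg b θ B)) (Verma.gen b θ B lam)

lemma exists_lieHom {V : Type*} [AddCommGroup V] [Module ℂ V] [LieRingModule (Toroidal B) V]
    [LieModule ℂ (Toroidal B) V] {v : V} (hv : IsImHighestVector b θ B lam v)
    (hgen : Generates B v) :
    ∃ f : Verma b θ B lam →ₗ⁅ℂ, Toroidal B⁆ V,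
      f (Verma.gen b θ B lam) = v ∧ Function.Surjective f := by
  obtain ⟨f, hf⟩ := Verma.exists_lift b θ B lam (envAct V) v (fun y hy => by
    obtain ⟨_, ⟨h, rfl⟩, x, hx, rfl⟩ := Submodule.mem_sup.mp hy
    rw [envAct, UniversalEnvelopingAlgebra.lift_ι_apply, LieModule.toEnd_apply_apply, add_lie,
      hv.pos_lie x hx, hv.weight h, map_add, projCartan_incl, projCartan_nPos b θ hx, add_zero,
      add_zero])
  refine ⟨{ f with map_lie' := fun {x w} => ?_ }, ?_, fun w => ?_⟩
  · obtain ⟨u, rfl⟩ := Verma.exists_smul_gen b θ B lam w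
    change f (UniversalEnvelopingAlgebra.ι ℂ x • u • Verma.gen b θ B lam) =
      ⁅x, f (u • Verma.gen b θ B lam)⁆
    rw [← mul_smul, hf, hf, map_mul, Module.End.mul_apply]
    nth_rw 1 [envAct]
    rw [UniversalEnvelopingAlgebra.lift_ι_apply, LieModule.toEnd_apply_apply]
  · change f (Verma.gen b θ B lam) = v
    have := hf 1
    rwa [one_smul, map_one] at this
  · obtain ⟨u, rfl⟩ := hgen w
    exact ⟨u • Verma.gen b θ B lam, hf u⟩

variable {B lam} in
lemma lieHom_smul {V : Type*} [AddCommGroup V] [Module ℂ V]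
    [LieRingModule (Toroidal B) V] [LieModule ℂ (Toroidal B) V]
    (f : Verma b θ B lam →ₗ⁅ℂ, Toroidal B⁆ V) (u : UniversalEnvelopingAlgebra ℂ (Toroidal B))
    (w : Verma b θ B lam) : f (u • w) = envAct V u (f w) := by
  induction u using env_induction generalizing w with
  | halg r => rw [AlgHom.commutes, Module.algebraMap_end_apply, algebraMap_smul, map_smul]
  | hι x =>
    rw [envAct, UniversalEnvelopingAlgebra.lift_ι_apply]
    exact f.map_lie x w
  | hmul a c ha hc => rw [mul_smul, ha, hc, map_mul, Module.End.mul_apply]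
  | hadd a c ha hc => rw [add_smul, map_add, ha, hc, map_add, LinearMap.add_apply]

variable {B} in
lemma envAct_verma (u : UniversalEnvelopingAlgebra ℂ (Toroidal B)) (w : Verma b θ B lam) :
    envAct (Verma b θ B lam) u w = u • w := (lieHom_smul LieModuleHom.id u w).symm

variable {B lam} in
-- The image of the generator is nonzero, since it determines `f`. A vector of the kernel is an
-- ordered combination `p` applied to the generator, so `p` kills that image; absence of torsion in
-- the polynomial model gives `p = 0`.
lemma lieHom_injective (hθ : ∀ α : H.root, b.height α ≤ b.height θ)
    {mu : Module.Dual ℂ (Cartan H)}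
    (f : Verma b θ B lam →ₗ⁅ℂ, Toroidal B⁆ Verma b θ B mu) (hf : f ≠ 0) :
    Function.Injective f := by
  have hsmul : ∀ u w, f (u • w) = u • f w := fun u w => by rw [lieHom_smul, envAct_verma]
  have hgen : f (Verma.gen b θ B lam) ≠ 0 := by
    intro h0
    refine hf (LieModuleHom.ext fun w => ?_)
    obtain ⟨u, rfl⟩ := Verma.exists_smul_gen b θ B lam w
    rw [hsmul, h0, smul_zero, LieModuleHom.zero_apply]
  obtain ⟨g, hg, hg'⟩ := exists_vermaMap_leftInverse B mu hθ
  have hginj : Function.Injective g := by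
    intro v w hvw
    obtain ⟨p, rfl⟩ := (vermaMap_bijective B mu hθ).2 v
    obtain ⟨q, rfl⟩ := (vermaMap_bijective B mu hθ).2 w
    rw [hg, hg] at hvw
    rw [hvw]
  rw [injective_iff_map_eq_zero]
  intro w hw
  obtain ⟨p, rfl⟩ := (vermaMap_bijective B lam hθ).2 w
  by_contra hp
  have hp0 : p ≠ 0 := by
    rintro rfl
    exact hp (map_zero _)
  have hr : g (f (Verma.gen b θ B lam)) ≠ 0 := (map_ne_zero_iff g hginj).mpr hgen
  refine (vermaDatum B mu hθ).envRep_ordMon_ne_zero hp0 hr ?_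
  rw [← hg', ← envMap_negDatum_ordMon, envMap_negDatum_ordMon B lam hθ, ← hsmul, ← vermaMap_apply,
    hw, map_zero]

end VermaBasis

end DoubleAffine

namespace DoubleAffine

open LieAlgebra.IsKilling

/-! ### Modules with a basis of weight vectors -/

section WeightBasis

variable {𝔤 : Type*} [LieRing 𝔤] [LieAlgebra ℂ 𝔤] {H : LieSubalgebra ℂ 𝔤} {B : InvForm 𝔤}
  {V κ : Type*} [AddCommGroup V] [Module ℂ V] [LieRingModule (Toroidal B) V]
  [LieModule ℂ (Toroidal B) V] {e : Module.Basis κ ℂ V} {wt : κ → Module.Dual ℂ (Cartan H)}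

lemma repr_incl_lie (he : ∀ i, e i ∈ wtSpace B V (wt i)) (h : Cartan H) (v : V) (i : κ) :
    e.repr ⁅Cartan.incl B h, v⁆ i = wt i h * e.repr v i := by
  have : e.coord i ∘ₗ LieModule.toEnd ℂ (Toroidal B) V (Cartan.incl B h) =
      wt i h • e.coord i := by
    refine e.ext fun j => ?_
    rw [LinearMap.comp_apply, LieModule.toEnd_apply_apply, he j h, map_smul, LinearMap.smul_apply]
    by_cases hij : j = i
    · rw [hij]
    · simp [hij]
  exact LinearMap.congr_fun this v

lemma wtSpace_eq_span (he : ∀ i, e i ∈ wtSpace B V (wt i)) (μ : Module.Dual ℂ (Cartan H)) :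
    wtSpace B V μ = Submodule.span ℂ (e '' {i | wt i = μ}) := by
  apply le_antisymm
  · intro v hv
    rw [Module.Basis.mem_span_image]
    intro i hi
    rw [Finset.mem_coe, Finsupp.mem_support_iff] at hi
    refine LinearMap.ext fun h => ?_
    have h1 := repr_incl_lie he h v i
    rw [hv h, map_smul, Finsupp.smul_apply, smul_eq_mul] at h1
    exact (mul_right_cancel₀ hi h1).symm
  · rw [Submodule.span_le]
    rintro _ ⟨i, rfl, rfl⟩
    exact he i

lemma rank_wtSpace (he : ∀ i, e i ∈ wtSpace B V (wt i)) (μ : Module.Dual ℂ (Cartan H)) :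
    Module.rank ℂ (wtSpace B V μ) = Cardinal.mk (e '' {i | wt i = μ}) := by
  rw [wtSpace_eq_span he]
  exact rank_span_set (e.linearIndependent.linearIndepOn_id.mono (Set.image_subset_range _ _))

/-- If `h` separates the weights of `e i` and `e i₀`, the operator `h - wt i h` kills the coordinate
at `i`, keeps the one at `i₀` nonzero and preserves `N`. Removing the other coordinates one by one
leaves a nonzero multiple of `e i₀`. -/
lemma mem_of_repr_ne_zero (he : ∀ i, e i ∈ wtSpace B V (wt i)) {i₀ : κ}
    (hwt : ∀ i, wt i = wt i₀ → i = i₀) (N : LieSubmodule ℂ (Toroidal B) V) {v : V} (hv : v ∈ N)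
    (h0 : e.repr v i₀ ≠ 0) : e i₀ ∈ N := by
  classical
  have key : ∀ F : Finset κ, ∀ v ∈ N, e.repr v i₀ ≠ 0 → (e.repr v).support ⊆ insert i₀ F →
      e i₀ ∈ N := by
    intro F
    induction F using Finset.induction_on with
    | empty =>
      intro v hv h0 hs
      have h1 : e.repr v = Finsupp.single i₀ (e.repr v i₀) := by
        rw [← Finsupp.support_subset_singleton]
        simpa using hs
      have h2 : v = e.repr v i₀ • e i₀ := by
        apply e.repr.injective
        rw [map_smul, e.repr_self, Finsupp.smul_single_one, ← h1]
      rw [h2] at hv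
      exact (Submodule.smul_mem_iff N.toSubmodule h0).mp hv
    | insert i F _ ih =>
      intro v hv h0 hs
      by_cases hi : i = i₀
      · refine ih v hv h0 (hs.trans ?_)
        rw [hi, Finset.insert_idem]
      obtain ⟨h, hh⟩ : ∃ h, wt i h ≠ wt i₀ h := by
        by_contra! hc
        exact hi (hwt i (LinearMap.ext hc))
      have hr : ∀ j, e.repr (⁅Cartan.incl B h, v⁆ - wt i h • v) j =
          (wt j h - wt i h) * e.repr v j := by
        intro j
        rw [map_sub, map_smul, Finsupp.sub_apply, Finsupp.smul_apply, repr_incl_lie he,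
          smul_eq_mul, sub_mul]
      refine ih (⁅Cartan.incl B h, v⁆ - wt i h • v)
        (sub_mem (N.lie_mem hv) (N.smul_mem _ hv)) ?_ fun j hj => ?_
      · rw [hr]
        exact mul_ne_zero (sub_ne_zero.mpr hh.symm) h0
      · rw [Finsupp.mem_support_iff, hr] at hj
        have h1 := hs (Finsupp.mem_support_iff.mpr (right_ne_zero_of_mul hj))
        rw [Finset.mem_insert, Finset.mem_insert] at h1
        rw [Finset.mem_insert]
        rcases h1 with h1 | rfl | h1
        · exact Or.inl h1
        · simp at hj
        · exact Or.inr h1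
  exact key _ v hv h0 (Finset.subset_insert _ _)

end WeightBasis

/-! ### Counting monomials of a given weight -/

section WeightCount

variable {𝔤 : Type*} [LieRing 𝔤] [LieAlgebra ℂ 𝔤] [FiniteDimensional ℂ 𝔤]
  [LieAlgebra.IsSimple ℂ 𝔤] {H : LieSubalgebra ℂ 𝔤} [H.IsCartanSubalgebra]
  {b : (rootSystem H).Base} {θ : H.root} {B : InvForm 𝔤}

lemma delta_apply_single (r : ℂ) :
    (delta 1 : Module.Dual ℂ (Cartan H)) (0, 0, Pi.single 1 r) = r := by
  simp [delta]

lemma nsmul_delta_injective {m n : ℕ}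
    (h : m • (delta 1 : Module.Dual ℂ (Cartan H)) = n • delta 1) :
    m = n := by
  have := LinearMap.congr_fun h (0, 0, Pi.single 1 1)
  rw [LinearMap.smul_apply, LinearMap.smul_apply, delta_apply_single] at this
  simpa using this

lemma negIdx_cases (hθ : ∀ α : H.root, b.height α ≤ b.height θ) (p : negIdx b θ B) :
    (loopWt p.1 (phi b θ)).re < 0 ∨ (loopWt p.1 (phi b θ) = 0 ∧ p.1.2.1.IsZero ∧ p.1.1 0 = 0 ∧
      ∃ n : ℕ, 0 < n ∧ p.1.1 1 = -n ∧ loopWt p.1 = -(n • delta 1)) := by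
  rcases posSet_cases b θ p.2 with h | ⟨n, hn, h⟩
  · left
    rw [LinearMap.neg_apply, Complex.neg_re] at h
    linarith
  · right
    have h' : loopWt p.1 = -(n • delta 1) := by rw [← h, neg_neg]
    have hphi : loopWt p.1 (phi b θ) = 0 := by
      rw [h', LinearMap.neg_apply, LinearMap.smul_apply, delta_phi, smul_zero, neg_zero]
    obtain ⟨h1, h2⟩ := eq_of_loopWt_phi_eq_zero hθ hphi
    refine ⟨hphi, h1, h2, n, hn, ?_, h'⟩
    have := LinearMap.congr_fun h' (0, 0, Pi.single 1 1)
    rw [LinearMap.neg_apply, LinearMap.smul_apply, delta_apply_single, loopWt_apply] at this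
    simp at this
    exact_mod_cast this

lemma mem_negIdx_of_phi {p : LoopIdx H} (h : (loopWt p (phi b θ)).re < 0) : p ∈ negIdx b θ B := by
  have hne : loopWt p ≠ 0 := by
    intro h0
    rw [h0] at h
    simp at h
  refine Or.inl ⟨⟨neg_ne_zero.mpr hne, rtSpace_neg_ne_bot hne (rtSpace_loopWt_ne_bot p)⟩, ?_⟩
  rw [LinearMap.neg_apply, Complex.neg_re]
  linarith

/-- The index of a vector of weight `-n δ₂`, `n ≥ 1`. -/
def imIdx (b : (rootSystem H).Base) (θ : H.root) (B : InvForm 𝔤) {j : RootIdx H} (hj : j.1.IsZero)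
    (n : ℕ) : negIdx b θ B :=
  -- The shift by one makes every natural number admissible: index `n` has weight `-(n + 1)δ₂`.
  ⟨(![0, -(n + 1 : ℕ)], j), Or.inr ⟨n + 1, n.succ_pos, by
    rw [loopWt_eq_of_isZero hj rfl]
    simp [add_smul, -smul_eq_mul, add_comm]⟩⟩

lemma loopWt_imIdx {j : RootIdx H} (hj : j.1.IsZero) (n : ℕ) :
    loopWt (imIdx b θ B hj n).1 = -((n + 1) • delta 1) := by
  rw [imIdx, loopWt_eq_of_isZero hj rfl, ← natCast_zsmul, ← neg_smul]
  rfl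

lemma imIdx_injective {j : RootIdx H} (hj : j.1.IsZero) :
    Function.Injective (imIdx b θ B hj) := by
  intro m n h
  have h' := congrArg (fun p : negIdx b θ B => loopWt p.1) h
  simp only [loopWt_imIdx] at h'
  have := nsmul_delta_injective (neg_injective h')
  omega

lemma monWt_eq_sum (M : negIdx b θ B →₀ ℕ) : monWt B M = ∑ p ∈ M.support, M p • loopWt p.1 := by
  simp [monWt, Finsupp.sum]

/-- A monomial whose weight is nonnegative on `φ` is a product of vectors of weights `-n δ₂`. -/
lemma loopWt_phi_eq_zero_of_monWt (hθ : ∀ α : H.root, b.height α ≤ b.height θ)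
    {M : negIdx b θ B →₀ ℕ} (hM : 0 ≤ (monWt B M (phi b θ)).re) {p : negIdx b θ B}
    (hp : p ∈ M.support) : loopWt p.1 (phi b θ) = 0 := by
  have hle : ∀ q : negIdx b θ B, (loopWt q.1 (phi b θ)).re ≤ 0 := by
    intro q
    rcases negIdx_cases hθ q with h | ⟨h, -⟩
    · exact h.le
    · rw [h, Complex.zero_re]
  have hle' : ∀ q ∈ M.support, ((M q • loopWt q.1) (phi b θ)).re ≤ 0 := by
    intro q _
    rw [LinearMap.smul_apply, nsmul_eq_mul, ← Complex.ofReal_natCast, Complex.re_ofReal_mul]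
    exact mul_nonpos_of_nonneg_of_nonpos (Nat.cast_nonneg _) (hle q)
  rw [monWt_eq_sum, LinearMap.sum_apply, Complex.re_sum] at hM
  have h0 := (Finset.sum_eq_zero_iff_of_nonpos hle').mp
    (le_antisymm (Finset.sum_nonpos hle') hM) p hp
  rw [LinearMap.smul_apply, nsmul_eq_mul, ← Complex.ofReal_natCast, Complex.re_ofReal_mul] at h0
  have h1 : (M p : ℝ) ≠ 0 := Nat.cast_ne_zero.mpr (Finsupp.mem_support_iff.mp hp)
  rcases negIdx_cases hθ p with h | ⟨h, -⟩
  · exact absurd ((mul_eq_zero.mp h0).resolve_left h1) h.ne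
  · exact h

/-- The weight of a product of vectors of weights `-n δ₂`. -/
lemma monWt_of_phi_eq_zero (hθ : ∀ α : H.root, b.height α ≤ b.height θ)
    {M : negIdx b θ B →₀ ℕ} (hM : ∀ p ∈ M.support, loopWt p.1 (phi b θ) = 0) :
    monWt B M = -((∑ p ∈ M.support, M p * (-p.1.1 1).toNat) • delta 1) := by
  rw [monWt_eq_sum, Finset.sum_smul, ← Finset.sum_neg_distrib]
  refine Finset.sum_congr rfl fun p hp => ?_
  rcases negIdx_cases hθ p with h | ⟨-, -, -, n, -, hn, h⟩
  · rw [hM p hp] at h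
    simp at h
  · rw [h, hn, neg_neg, Int.toNat_natCast, mul_smul, smul_neg]

lemma of_monWt_eq (hθ : ∀ α : H.root, b.height α ≤ b.height θ) {M : negIdx b θ B →₀ ℕ} {k : ℕ}
    (hM : monWt B M = -(k • delta 1)) :
    (∀ p ∈ M.support, loopWt p.1 (phi b θ) = 0) ∧
      ∑ p ∈ M.support, M p * (-p.1.1 1).toNat = k := by
  have h : ∀ p ∈ M.support, loopWt p.1 (phi b θ) = 0 := fun p hp =>
    loopWt_phi_eq_zero_of_monWt hθ (by rw [hM]; simp [delta_phi]) hp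
  refine ⟨h, ?_⟩
  rw [monWt_of_phi_eq_zero hθ h] at hM
  exact nsmul_delta_injective (neg_injective hM)

/-- Such a monomial is a coloured partition of `k`, so its parts and multiplicities are at most `k`.
-/
lemma of_mem_support (hθ : ∀ α : H.root, b.height α ≤ b.height θ) {M : negIdx b θ B →₀ ℕ} {k : ℕ}
    (hM : monWt B M = -(k • delta 1)) {p : negIdx b θ B} (hp : p ∈ M.support) :
    M p ≤ k ∧ p.1.1 0 = 0 ∧ 0 < (-p.1.1 1) ∧ (-p.1.1 1).toNat ≤ k := by
  obtain ⟨h1, h2⟩ := of_monWt_eq hθ hM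
  have h3 := Finset.single_le_sum (f := fun p => M p * (-p.1.1 1).toNat)
    (fun _ _ => Nat.zero_le _) hp
  rw [h2] at h3
  have h4 := Nat.pos_of_ne_zero (Finsupp.mem_support_iff.mp hp)
  rcases negIdx_cases hθ p with h | ⟨-, -, h5, n, hn, hn', -⟩
  · rw [h1 p hp] at h
    simp at h
  · simp only [hn', neg_neg, Int.toNat_natCast] at h3 ⊢
    exact ⟨le_trans (Nat.le_mul_of_pos_right _ hn) h3, h5, by omega,
      le_trans (Nat.le_mul_of_pos_left _ h4) h3⟩

lemma monWt_eq_zero_iff (hθ : ∀ α : H.root, b.height α ≤ b.height θ) {M : negIdx b θ B →₀ ℕ} :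
    monWt B M = 0 ↔ M = 0 := by
  refine ⟨fun h => ?_, fun h => by rw [h, map_zero]⟩
  by_contra hM
  obtain ⟨p, hp⟩ := Finsupp.support_nonempty_iff.mpr hM
  have := of_mem_support hθ (k := 0) (by rw [h, zero_smul, neg_zero]) hp
  have := Finsupp.mem_support_iff.mp hp
  omega

lemma finite_monWt (hθ : ∀ α : H.root, b.height α ≤ b.height θ) (k : ℕ) :
    {M : negIdx b θ B →₀ ℕ | monWt B M = -(k • delta 1)}.Finite := by
  classical
  have : Finite (RootIdx H) := Module.Finite.finite_basis (rootBasis H)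
  have hF : {p : negIdx b θ B | p.1.1 ∈ Set.Icc (fun _ => -(k : ℤ)) (fun _ => (k : ℤ))}.Finite :=
    (((Set.finite_Icc (fun _ : Fin 2 => -(k : ℤ)) (fun _ => (k : ℤ))).prod
      (Set.finite_univ (α := RootIdx H))).preimage
        (f := fun p : negIdx b θ B => p.1) Subtype.val_injective.injOn).subset
      fun p hp => ⟨hp, Set.mem_univ _⟩
  -- The bounds confine the support to a finite box of indices and the exponents to at most `k`, so
  -- the monomials lie in an order interval of finitely supported functions.
  refine (Set.finite_Icc 0 (∑ p ∈ hF.toFinset, Finsupp.single p k)).subset fun M hM => ?_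
  refine ⟨zero_le, fun p => ?_⟩
  by_cases hp : p ∈ M.support
  · obtain ⟨h1, h2, h3, h4⟩ := of_mem_support hθ hM hp
    have hpF : p ∈ hF.toFinset := by
      rw [Set.Finite.mem_toFinset]
      constructor <;> intro i <;> fin_cases i <;> simp <;> omega
    rw [Finsupp.finsetSum_apply]
    refine h1.trans ?_
    have := Finset.single_le_sum (f := fun q => (Finsupp.single q k : negIdx b θ B →₀ ℕ) p)
      (fun _ _ => Nat.zero_le _) hpF
    simpa using this
  · rw [Finsupp.notMem_support_iff.mp hp]
    exact Nat.zero_le _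

lemma infinite_monWt (hθ : ∀ α : H.root, b.height α ≤ b.height θ) (M : negIdx b θ B →₀ ℕ)
    (hM : ∀ k : ℕ, monWt B M ≠ -(k • delta 1)) :
    {N : negIdx b θ B →₀ ℕ | monWt B N = monWt B M}.Infinite := by
  classical
  obtain ⟨j, hj⟩ := exists_isZero θ
  obtain ⟨p, hp, hphi⟩ : ∃ p ∈ M.support, loopWt p.1 (phi b θ) ≠ 0 := by
    by_contra! hc
    exact hM _ (monWt_of_phi_eq_zero hθ hc)
  have hlt : (loopWt p.1 (phi b θ)).re < 0 :=
    (negIdx_cases hθ p).resolve_right fun h => hphi h.1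
  -- One factor with `φ`-value negative is shifted by `(n + 1)δ₂`. As `δ₂(φ) = 0`, the shifted index
  -- still belongs to `-𝓘`; a factor of weight `-(n + 1)δ₂` will compensate for the shift.
  let s : ℕ → LoopIdx H := fun n => (![p.1.1 0, p.1.1 1 + (n + 1 : ℕ)], p.1.2)
  have hs : ∀ n, loopWt (s n) = loopWt p.1 + (n + 1) • delta 1 := by
    intro n
    refine LinearMap.ext fun h => ?_
    rw [LinearMap.add_apply, LinearMap.smul_apply, loopWt_apply, loopWt_apply]
    simp [s, delta]
    ring
  have hsphi : ∀ n, loopWt (s n) (phi b θ) = loopWt p.1 (phi b θ) := by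
    intro n
    rw [hs, LinearMap.add_apply, LinearMap.smul_apply, delta_phi, smul_zero, add_zero]
  let q : ℕ → negIdx b θ B := fun n => ⟨s n, mem_negIdx_of_phi (by rwa [hsphi])⟩
  have hq : ∀ m n, q m ≠ imIdx b θ B hj n := by
    intro m n h
    have h1 : loopWt (q m).1 (phi b θ) = _ := hsphi m
    rw [h, loopWt_imIdx, LinearMap.neg_apply, LinearMap.smul_apply, delta_phi, smul_zero,
      neg_zero] at h1
    exact hphi h1.symm
  have hle : Finsupp.single p 1 ≤ M := by
    rw [Finsupp.single_le_iff]
    exact Nat.one_le_iff_ne_zero.mpr (Finsupp.mem_support_iff.mp hp)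
  refine Set.infinite_of_injective_forall_mem (f := fun n : ℕ =>
    (M - Finsupp.single p 1) + (Finsupp.single (q n) 1 + Finsupp.single (imIdx b θ B hj n) 1))
    (fun m n hmn => ?_) fun n => ?_
  · by_contra hne
    -- The exponent at the compensating factor distinguishes the monomials, because by `hq` the
    -- shifted factors never coincide with it.
    have h1 := DFunLike.congr_fun (add_left_cancel hmn) (imIdx b θ B hj m)
    rw [Finsupp.add_apply, Finsupp.add_apply, Finsupp.single_eq_same,
      Finsupp.single_eq_of_ne' (hq _ _), Finsupp.single_eq_of_ne' (hq _ _),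
      Finsupp.single_eq_of_ne' (fun h => hne (imIdx_injective hj h).symm)] at h1
    omega
  · change monWt B _ = monWt B M
    conv_rhs => rw [← tsub_add_cancel_of_le hle]
    rw [map_add, map_add, map_add, monWt_single, monWt_single, monWt_single, loopWt_imIdx,
      one_smul, one_smul, one_smul]
    congr 1
    change loopWt (s n) + _ = _
    rw [hs, add_neg_cancel_right]

end WeightCount

/-! ### Weight multiplicities and the maximal submodule -/

section WeightSpaces

variable {𝔤 : Type*} [LieRing 𝔤] [LieAlgebra ℂ 𝔤] [FiniteDimensional ℂ 𝔤]
  [LieAlgebra.IsSimple ℂ 𝔤] {H : LieSubalgebra ℂ 𝔤} [H.IsCartanSubalgebra]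
  {b : (rootSystem H).Base} {θ : H.root} (B : InvForm 𝔤) (lam : Module.Dual ℂ (Cartan H))

lemma rank_wtSpace_self (hθ : ∀ α : H.root, b.height α ≤ b.height θ) :
    Module.rank ℂ (wtSpace B (Verma b θ B lam) lam) = 1 := by
  rw [rank_wtSpace (vermaBasis_mem B lam hθ)]
  have : {M : negIdx b θ B →₀ ℕ | lam + monWt B M = lam} = {0} := by
    ext M
    simp [monWt_eq_zero_iff hθ]
  rw [this, Set.image_singleton, Cardinal.mk_singleton]

lemma rank_wtSpace_sub (hθ : ∀ α : H.root, b.height α ≤ b.height θ) (k : ℕ) :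
    0 < Module.rank ℂ (wtSpace B (Verma b θ B lam) (lam - k • delta 1)) ∧
      Module.rank ℂ (wtSpace B (Verma b θ B lam) (lam - k • delta 1)) < Cardinal.aleph0 := by
  rw [rank_wtSpace (vermaBasis_mem B lam hθ)]
  have hset : {M : negIdx b θ B →₀ ℕ | lam + monWt B M = lam - k • delta 1} =
      {M | monWt B M = -(k • delta 1)} := by
    ext M
    rw [Set.mem_ofPred_eq, Set.mem_ofPred_eq, sub_eq_add_neg, add_right_inj]
  rw [hset]
  constructor
  · rw [pos_iff_ne_zero, Cardinal.mk_ne_zero_iff, Set.nonempty_coe_sort, Set.image_nonempty]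
    rcases k with _ | k
    · exact ⟨0, by simp⟩
    · obtain ⟨j, hj⟩ := exists_isZero θ
      refine ⟨Finsupp.single (imIdx b θ B hj k) 1, ?_⟩
      rw [Set.mem_ofPred_eq, monWt_single, one_smul, loopWt_imIdx]
  · rw [Cardinal.lt_aleph0_iff_set_finite]
    exact (finite_monWt hθ k).image _

lemma aleph0_le_rank_wtSpace (hθ : ∀ α : H.root, b.height α ≤ b.height θ)
    {μ : Module.Dual ℂ (Cartan H)}
    (hμ : wtSpace B (Verma b θ B lam) μ ≠ ⊥) (hk : ∀ k : ℕ, μ ≠ lam - k • delta 1) :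
    Cardinal.aleph0 ≤ Module.rank ℂ (wtSpace B (Verma b θ B lam) μ) := by
  rw [wtSpace_eq_span (vermaBasis_mem B lam hθ)] at hμ
  obtain ⟨M, hM⟩ : {M : negIdx b θ B →₀ ℕ | lam + monWt B M = μ}.Nonempty := by
    rw [Set.nonempty_iff_ne_empty]
    intro h
    rw [h, Set.image_empty, Submodule.span_empty] at hμ
    exact hμ rfl
  rw [rank_wtSpace (vermaBasis_mem B lam hθ), Cardinal.aleph0_le_mk_iff, Set.infinite_coe_iff]
  refine Set.Infinite.image (vermaBasis B lam hθ).injective.injOn ?_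
  refine (infinite_monWt hθ M fun k h => hk k ?_).mono fun N hN => ?_
  · rw [← hM, h, sub_eq_add_neg]
  · rw [Set.mem_ofPred_eq] at hM hN ⊢
    rw [hN, hM]

lemma eq_top_of_gen_mem {N : LieSubmodule ℂ (Toroidal B) (Verma b θ B lam)}
    (h : Verma.gen b θ B lam ∈ N) : N = ⊤ := by
  rw [eq_top_iff]
  intro w hw
  obtain ⟨u, rfl⟩ := Verma.exists_smul_gen b θ B lam w
  clear hw
  have key : ∀ w ∈ N, u • w ∈ N := by
    induction u using env_induction with
    | halg r =>
      intro w hw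
      rw [algebraMap_smul]
      exact N.smul_mem r hw
    | hι x => exact fun w hw => N.lie_mem hw
    | hmul a c ha hc =>
      intro w hw
      rw [mul_smul]
      exact ha _ (hc _ hw)
    | hadd a c ha hc =>
      intro w hw
      rw [add_smul]
      exact add_mem (ha _ hw) (hc _ hw)
  exact key _ h

/-- The weight `λ` occurs once in the basis, so a submodule containing a vector with nonzero
coordinate at the generator contains the generator and is everything. Thus all proper submodules lie
in one hyperplane, their sum is proper, and it is the only maximal one. -/
lemma existsUnique_isCoatom (hθ : ∀ α : H.root, b.height α ≤ b.height θ) :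
    ∃! J : LieSubmodule ℂ (Toroidal B) (Verma b θ B lam), IsCoatom J := by
  have hproper : ∀ N : LieSubmodule ℂ (Toroidal B) (Verma b θ B lam), N ≠ ⊤ →
      N.toSubmodule ≤ LinearMap.ker ((vermaBasis B lam hθ).coord 0) := by
    intro N hN v hv
    by_contra h0
    refine hN (eq_top_of_gen_mem B lam ?_)
    rw [← vermaBasis_zero B lam hθ]
    refine mem_of_repr_ne_zero (vermaBasis_mem B lam hθ) (fun M hM => ?_) N hv h0
    rw [map_zero, add_right_inj] at hM
    exact (monWt_eq_zero_iff hθ).mp hM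
  let J : LieSubmodule ℂ (Toroidal B) (Verma b θ B lam) := sSup {N | N ≠ ⊤}
  have hJle : J.toSubmodule ≤ LinearMap.ker ((vermaBasis B lam hθ).coord 0) := by
    rw [LieSubmodule.sSup_toSubmodule, sSup_le_iff]
    rintro _ ⟨N, hN, rfl⟩
    exact hproper N hN
  have hJ : J ≠ ⊤ := by
    intro h
    have h1 : vermaBasis B lam hθ 0 ∈ J.toSubmodule := by rw [h]; trivial
    have h2 := hJle h1
    simp at h2
  have hle : ∀ N, N ≠ ⊤ → N ≤ J := fun N hN => le_sSup hN
  refine ⟨J, ⟨hJ, fun N hN => ?_⟩, fun N hN => ?_⟩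
  · by_contra h
    exact hN.not_ge (hle N h)
  · by_contra h
    exact hJ (hN.2 J (lt_of_le_of_ne (hle N hN.1) h))

end WeightSpaces

end DoubleAffine

end

open DoubleAffine LieAlgebra.IsKilling in
theorem mainTheorem7 {𝔤 : Type*} [LieRing 𝔤] [LieAlgebra ℂ 𝔤] [FiniteDimensional ℂ 𝔤]
    [LieAlgebra.IsSimple ℂ 𝔤] (H : LieSubalgebra ℂ 𝔤) [H.IsCartanSubalgebra]
    (b : (rootSystem H).Base) (hb : b.cartanMatrix.IsSimplyLaced)
    (θ : H.root) (hθ : ∀ α : H.root, b.height α ≤ b.height θ)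
    (B : InvForm 𝔤) (lam : Module.Dual ℂ (Cartan H)) :
    -- freeness over `U(𝔗_{-𝓘})`
    (IsImHighestVector b θ B lam (Verma.gen b θ B lam) ∧
      ∃ e : Module.Basis Unit (UniversalEnvelopingAlgebra ℂ (nNeg b θ B)) (Verma b θ B lam),
        e () = Verma.gen b θ B lam) ∧
    -- weight spaces
    (Module.rank ℂ (wtSpace B (Verma b θ B lam) lam) = 1 ∧
      (∀ k : ℕ, 0 < k →
        0 < Module.rank ℂ (wtSpace B (Verma b θ B lam) (lam - k • delta 1)) ∧
        Module.rank ℂ (wtSpace B (Verma b θ B lam) (lam - k • delta 1)) < Cardinal.aleph0) ∧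
      ∀ μ : Module.Dual ℂ (Cartan H), wtSpace B (Verma b θ B lam) μ ≠ ⊥ →
        (∀ k : ℕ, μ ≠ lam - k • delta 1) →
        Cardinal.aleph0 ≤ Module.rank ℂ (wtSpace B (Verma b θ B lam) μ)) ∧
    -- universal property
    (∀ (V : Type*) [AddCommGroup V] [Module ℂ V] [LieRingModule (Toroidal B) V]
      [LieModule ℂ (Toroidal B) V] (v : V),
      IsImHighestVector b θ B lam v → Generates B v →
        ∃ f : Verma b θ B lam →ₗ⁅ℂ, Toroidal B⁆ V,
          f (Verma.gen b θ B lam) = v ∧ Function.Surjective f) ∧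
    -- maximal submodule
    (∃! J : LieSubmodule ℂ (Toroidal B) (Verma b θ B lam), IsCoatom J) ∧
    -- homomorphisms
    (∀ (μ : Module.Dual ℂ (Cartan H)) (f : Verma b θ B lam →ₗ⁅ℂ, Toroidal B⁆ Verma b θ B μ),
      f ≠ 0 → Function.Injective f) :=
  ⟨⟨isImHighestVector_gen B lam hθ, exists_basis_gen B lam hθ⟩,
    ⟨rank_wtSpace_self B lam hθ, fun k _ => rank_wtSpace_sub B lam hθ k,
      fun _ hμ hk => aleph0_le_rank_wtSpace B lam hθ hμ hk⟩,
    fun _ _ _ _ _ _ hv hgen => exists_lieHom B lam hv hgen,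
    existsUnique_isCoatom B lam hθ,
    fun _ f hf => lieHom_injective hθ f hf⟩
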